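/- **Uniform approximation theorem.** For $N\in\mathbb N=\{1,2,\dots\}$ let $\mathbb W_N=\{\mathbf x\in\mathbb R^N: x_1\ge\dots\ge x_N\}$ and $\mathbb W_{N,+}=\mathbb W_N\cap[0,\infty)^N$. For a Hermitian $N\times N$ matrix $\mathbf A$ let $\mathsf{eval}_N(\mathbf A)\in\mathbb W_N$ be its ordered vector of eigenvalues. *Finite kernels.* For $\mathbf x\in\mathbb W_{N+1}$ let $\Lambda_N^{N+1}(\mathbf x,\cdot)$ be the law of $\mathsf{eval}_N$ of the top-left $N\times N$ corner of $\mathbf U\,\mathrm{diag}(\mathbf x)\,\mathbf U^\dagger$, where $\mathbf U$ is Haar distributed on $\mathbb U(N+1)$. For $N>K\ge1$ put $\Lambda_K^N=\Lambda_{N-1}^N\Lambda_{N-2}^{N-1}\cdots\Lambda_K^{K+1}$ (composition of Markov kernels); it is a kernel from $\mathbb W_N$ to $\mathbb W_K$, and restricts to a kernel from $\mathbb W_{N,+}$ to $\mathbb W_{K,+}$. *Boundary kernels.* Let $\mathbb W_{\infty,+}$ be the set of real sequences $x_1\ge x_2\ge\dots\ge0$, $$\Omega=\Big\{(\mathbf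 x^+,\mathbf x^-,\gamma,\delta)\in\mathbb W_{\infty,+}^2\times\mathbb R\times\mathbb R_+:\ \sum_i(x_i^+)^2+\sum_i(x_i^-)^2\le\delta\Big\},\qquad \Omega_+=\Big\{(\mathbf x,\gamma)\in\mathbb W_{\infty,+}\times\mathbb R_+:\ \sum_i x_i\le\gamma\Big\}.$$ Let $\mathbf G$ be an infinite Hermitian Gaussian matrix with diagonal entries $\mathcal N(0,1)$ and with real and imaginary parts of the entries above the diagonal $\mathcal N(0,\tfrac12)$, and let $\boldsymbol\xi(j),\boldsymbol\zeta(j)$, $j\ge1$, be infinite vectors of standard complex Gaussian variables (real and imaginary parts independent $\mathcal N(0,\tfrac12)$), everything independent. Put $$\mathbf A_\omega=\gamma\mathbf I+\sqrt{\delta-\sum_i[(x_i^+)^2+(x_i^-)^2]}\;\mathbf G+\sum_j x_j^+\big(\boldsymbol\xi(j)\boldsymbol\xi(j)^\dagger-\mathbf I\big)-\sum_j x_j^-\big(\boldsymbol\zeta(j)\boldsymbol\zeta(j)^\dagger-\mathbf I\big)\quad(\omega\in\Omega),$$ $$\mathbf A_\omega=\Big(\gamma-\sum_jx_j\Big)\mathbf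 I+\sum_jx_j\,\boldsymbol\xi(j)\boldsymbol\xi(j)^\dagger\quad(\omega\in\Omega_+),$$ where the series of matrices are entrywise almost sure limits of their partial sums. In both cases let $\Lambda_K^\infty(\omega,\cdot)$ be the law of $\mathsf{eval}_K$ of the top-left $K\times K$ corner of $\mathbf A_\omega$. *Embeddings.* For $\mathbf x\in\mathbb W_N$, with $x_i:=0$ for $i\notin\{1,\dots,N\}$, let $$\omega(\mathbf x)=\Big(\big(N^{-1}\max\{x_i,0\}\big)_{i\ge1},\ \big(N^{-1}\max\{-x_{N+1-i},0\}\big)_{i\ge1},\ N^{-1}\sum_{i=1}^N x_i,\ N^{-2}\sum_{i=1}^N x_i^2\Big)\in\Omega,$$ and for $\mathbf x\in\mathbb W_{N,+}$ let (abusing notation) $\omega(\mathbf x)=\big((N^{-1}x_i)_{i\ge1},\,N^{-1}\sum_{i=1}^N x_i\big)\in\Omega_+$. *Action on functions.* A probability measure $\mu$ on $\mathbb W_K$ is extended symmetrically to a measure on $\mathbb R^K$ of total mass $K!$, the sum over all $\sigma\in\mathbb S_K$ of the images of $\mu$ under $(y_i)_i\mapsto(y_{\sigma(i)})_i$. For $g:\mathbb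 R^K\to\mathbb R$, write $\Lambda_K^Ng(\mathbf x)$ and $\Lambda_K^\infty g(\omega)$ for the integrals of $g$ against the symmetric extensions of $\Lambda_K^N(\mathbf x,\cdot)$ and $\Lambda_K^\infty(\omega,\cdot)$. **Theorem.** Let $K\in\mathbb N$, and let $(\mathcal E_N)_{N\ge1}$ be either $(\mathbb W_N)_{N\ge1}$, with $\omega(\cdot)\in\Omega$, or $(\mathbb W_{N,+})_{N\ge1}$, with $\omega(\cdot)\in\Omega_+$. Then for every $g\in C_c^\infty(\mathbb R^K)$, $$\sup_{\mathbf x^{(N)}\in\mathcal E_N}\Big|\Lambda_K^\infty g\big(\omega(\mathbf x^{(N)})\big)-\Lambda_K^N g\big(\mathbf x^{(N)}\big)\Big|\longrightarrow0\qquad\text{as }N\to\infty .$$ -/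

import Mathlib

open MeasureTheory ProbabilityTheory Filter Topology
open scoped Matrix ENNReal NNReal

noncomputable section

namespace CornerKernels

/-! ### Weyl chambers and ordered eigenvalues -/

/-- The Weyl chamber `𝕎_N` of non-increasing real `N`-tuples. -/
abbrev WeylChamber (N : ℕ) : Type := {x : Fin N → ℝ // Antitone x}

/-- The non-negative Weyl chamber `𝕎_{N,+}`, as a set of points of `𝕎_N`. -/
abbrev PosWeylChamber (N : ℕ) : Type := {x : WeylChamber N // ∀ i, 0 ≤ x.1 i}

/-- The space `ℍ(N)` of `N × N` complex Hermitian matrices. -/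
abbrev HermitianMatrix (N : ℕ) : Type := {A : Matrix (Fin N) (Fin N) ℂ // A.IsHermitian}

/-- The Borel (= product) sigma-algebra on complex matrices. -/
instance instMeasurableSpaceMatrix {m n : Type*} : MeasurableSpace (Matrix m n ℂ) :=
  inferInstanceAs (MeasurableSpace (m → n → ℂ))

instance instBorelSpaceMatrix {m n : Type*} [Countable m] [Countable n] :
    BorelSpace (Matrix m n ℂ) :=
  inferInstanceAs (BorelSpace (m → n → ℂ))

/-- The eigenvalue map `eval_N : ℍ(N) → 𝕎_N`: eigenvalues with multiplicity,
in non-increasing order. -/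
def eval (N : ℕ) (A : HermitianMatrix N) : WeylChamber N :=
  ⟨fun i => A.2.eigenvalues₀ (Fin.cast (Fintype.card_fin N).symm i),
    fun _ _ h => A.2.eigenvalues₀_antitone h⟩

/-- Values at the integers of the monic polynomial with roots `x`. -/
def monicValues (N : ℕ) (x : WeylChamber N) (t : ℕ) : ℝ := ∏ i, ((t : ℝ) - x.1 i)

theorem continuous_monicValues (N : ℕ) : Continuous (monicValues N) := by
  refine continuous_pi fun t => continuous_finsetProd _ fun i _ => ?_
  exact continuous_const.sub ((continuous_apply i).comp continuous_subtype_val)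

theorem injective_monicValues (N : ℕ) : Function.Injective (monicValues N) := by
  intro x y h
  have hp : (∏ i, (Polynomial.X - Polynomial.C (x.1 i)))
      = ∏ i, (Polynomial.X - Polynomial.C (y.1 i)) := by
    refine Polynomial.eq_of_infinite_eval_eq _ _ ((Set.infinite_range_of_injective
      (Nat.cast_injective (R := ℝ))).mono ?_)
    rintro _ ⟨t, rfl⟩
    have := congrFun h t
    simpa [monicValues, Polynomial.eval_prod] using this
  have hr := congrArg Polynomial.roots hp
  rw [Polynomial.roots_prod _ _ (Finset.prod_ne_zero_iff.2 fun i _ => Polynomial.X_sub_C_ne_zero _),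
    Polynomial.roots_prod _ _ (Finset.prod_ne_zero_iff.2 fun i _ => Polynomial.X_sub_C_ne_zero _)]
    at hr
  simp only [Polynomial.roots_X_sub_C, Multiset.bind_singleton, Fin.univ_val_map,
    Multiset.coe_eq_coe] at hr
  have hl := hr.eq_of_pairwise' x.2.sortedGE_ofFn.pairwise y.2.sortedGE_ofFn.pairwise
  exact Subtype.ext (List.ofFn_injective hl)

theorem monicValues_eval (N : ℕ) (A : HermitianMatrix N) (t : ℕ) :
    monicValues N (eval N A) t = ((Matrix.scalar (Fin N) (t : ℂ) - A.1).det).re := by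
  have h1 := Matrix.eval_charpoly A.1 (t : ℂ)
  have h2 : A.1.charpoly.eval (t : ℂ)
      = ∏ i, ((t : ℂ) - (A.2.eigenvalues₀ i : ℂ)) := by
    have hs : A.1.charpoly.Splits := IsAlgClosed.splits _
    rw [hs.eval_eq_prod_roots_of_monic (Matrix.charpoly_monic _),
      A.2.roots_charpoly_eq_eigenvalues₀, Multiset.map_map]
    rfl
  rw [← h1, h2]
  have h3 : (∏ i, ((t : ℂ) - (A.2.eigenvalues₀ i : ℂ)))
      = ((∏ i, ((t : ℝ) - A.2.eigenvalues₀ i) : ℝ) : ℂ) := by push_cast; rfl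
  rw [h3, Complex.ofReal_re]
  exact Fintype.prod_equiv (finCongr (Fintype.card_fin N).symm) _ _ fun i => rfl

theorem measurable_eval (N : ℕ) : Measurable (eval N) := by
  have hc : IsClosed {x : Fin N → ℝ | Antitone x} := by
    simp only [Antitone, Set.ofPred_forall]
    exact isClosed_iInter fun i => isClosed_iInter fun j => isClosed_iInter fun _ =>
      isClosed_le (continuous_apply j) (continuous_apply i)
  have : PolishSpace (WeylChamber N) := hc.polishSpace
  have he : MeasurableEmbedding (monicValues N) :=
    (continuous_monicValues N).measurableEmbedding (injective_monicValues N)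
  rw [← he.measurable_comp_iff, measurable_pi_iff]
  intro t
  simp only [Function.comp_apply, monicValues_eval]
  have hcont : Continuous fun A : HermitianMatrix N =>
      ((Matrix.scalar (Fin N) (t : ℂ) - A.1).det).re :=
    Complex.continuous_re.comp (continuous_const.sub continuous_subtype_val).matrix_det
  exact hcont.measurable

/-! ### Haar measure on the unitary group and the kernels `Λ_K^N` -/

instance instCompactSpaceUnitary (N : ℕ) : CompactSpace (Matrix.unitaryGroup (Fin N) ℂ) := by
  refine isCompact_iff_compactSpace.1 (?_ : IsCompact
    (Matrix.unitaryGroup (Fin N) ℂ : Set (Matrix (Fin N) (Fin N) ℂ)))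
  have hk : IsCompact (Set.pi Set.univ fun _ : Fin N => Set.pi Set.univ fun _ : Fin N =>
      Metric.closedBall (0 : ℂ) 1) :=
    isCompact_univ_pi fun _ => isCompact_univ_pi fun _ => isCompact_closedBall 0 1
  refine IsCompact.of_isClosed_subset hk isClosed_unitary fun U hU => ?_
  exact fun i _ j _ => mem_closedBall_zero_iff.2 (entry_norm_bound_of_unitary hU i j)

/-- The Haar probability measure on `𝕌(N)`. -/
def haarUnitary (N : ℕ) : Measure (Matrix.unitaryGroup (Fin N) ℂ) :=
  Measure.haarMeasure ⊤

instance (N : ℕ) : IsProbabilityMeasure (haarUnitary N) :=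
  ⟨by simpa [haarUnitary] using
    Measure.haarMeasure_self (G := Matrix.unitaryGroup (Fin N) ℂ) (K₀ := ⊤)⟩

/-- The corners map `Π_N^{N+1} : ℍ(N+1) → ℍ(N)`. -/
def corner (N : ℕ) (A : HermitianMatrix (N + 1)) : HermitianMatrix N :=
  ⟨A.1.submatrix Fin.castSucc Fin.castSucc, A.2.submatrix _⟩

/-- The Hermitian matrix `U diag(x) U†`. -/
def conjDiag (N : ℕ) (U : Matrix.unitaryGroup (Fin N) ℂ) (x : WeylChamber N) :
    HermitianMatrix N :=
  ⟨U.1 * Matrix.diagonal (fun i => (x.1 i : ℂ)) * U.1ᴴ,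
    Matrix.isHermitian_mul_mul_conjTranspose _
      (Matrix.isHermitian_diagonal_of_self_adjoint _ (by
        ext i; simp))⟩

theorem measurable_corner_conjDiag (N : ℕ) :
    Measurable fun p : WeylChamber (N + 1) × Matrix.unitaryGroup (Fin (N + 1)) ℂ =>
      eval N (corner N (conjDiag (N + 1) p.2 p.1)) := by
  refine (measurable_eval N).comp (Continuous.measurable ?_)
  refine Continuous.subtype_mk (Continuous.matrix_submatrix ?_ _ _) _
  have h2 : Continuous fun p : WeylChamber (N + 1) × Matrix.unitaryGroup (Fin (N + 1)) ℂ =>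
      p.2.1 := continuous_subtype_val.comp continuous_snd
  refine (h2.mul (Continuous.matrix_diagonal ?_)).mul h2.matrix_conjTranspose
  exact continuous_pi fun i => Complex.continuous_ofReal.comp
    ((continuous_apply i).comp (continuous_subtype_val.comp continuous_fst))

/-- The Markov kernel `Λ_N^{N+1}` from `𝕎_{N+1}` to `𝕎_N`:
`Λ_N^{N+1}(x, ·) = Law [eval_N (Π_N^{N+1} (U diag(x) U†))]`, with `U` Haar distributed. -/
def link (N : ℕ) : Kernel (WeylChamber (N + 1)) (WeylChamber N) where
  toFun x := (haarUnitary (N + 1)).map fun U => eval N (corner N (conjDiag (N + 1) U x))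
  measurable' := by
    refine Measure.measurable_of_measurable_coe _ fun s hs => ?_
    have h := measurable_corner_conjDiag N
    have : ∀ x : WeylChamber (N + 1),
        ((haarUnitary (N + 1)).map fun U => eval N (corner N (conjDiag (N + 1) U x))) s
          = haarUnitary (N + 1) (Prod.mk x ⁻¹'
            ((fun p : WeylChamber (N + 1) × Matrix.unitaryGroup (Fin (N + 1)) ℂ =>
              eval N (corner N (conjDiag (N + 1) p.2 p.1))) ⁻¹' s)) := fun x => by
      exact Measure.map_apply (h.comp measurable_prodMk_left) hs
    simp only [this]
    exact measurable_measure_prodMk_left (h hs)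

/-- The composition `Λ_K^N = Λ_{N-1}^N Λ_{N-2}^{N-1} ⋯ Λ_K^{K+1}` (for `N = K`: the identity).
Note that `κ ∘ₖ η` means: first `η`, then `κ`. -/
def cornerKernel (K : ℕ) {N : ℕ} (h : K ≤ N) : Kernel (WeylChamber N) (WeylChamber K) :=
  Nat.leRec (motive := fun N _ => Kernel (WeylChamber N) (WeylChamber K))
    Kernel.id (fun N _ κ => κ ∘ₖ link N) h

/-! ### The boundary spaces and the embeddings of the Weyl chambers -/

/-- The set `𝕎_{∞,+}` of non-increasing sequences of non-negative reals. -/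
abbrev InfWeylChamber : Type := {x : ℕ → ℝ // Antitone x ∧ ∀ i, 0 ≤ x i}

/-- The space `Ω` of `ω = (x⁺, x⁻, γ, δ)` with `∑ (x⁺ᵢ)² + ∑ (x⁻ᵢ)² ≤ δ`. -/
structure Omega where
  xp : InfWeylChamber
  xm : InfWeylChamber
  γ : ℝ
  δ : ℝ
  δ_nonneg : 0 ≤ δ
  summable_xp : Summable fun i => xp.1 i ^ 2
  summable_xm : Summable fun i => xm.1 i ^ 2
  sum_le : ∑' i, xp.1 i ^ 2 + ∑' i, xm.1 i ^ 2 ≤ δ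

/-- The space `Ω₊` of `ω = (x, γ)` with `∑ xᵢ ≤ γ`. -/
structure OmegaPos where
  x : InfWeylChamber
  γ : ℝ
  γ_nonneg : 0 ≤ γ
  summable_x : Summable fun i => x.1 i
  sum_le : ∑' i, x.1 i ≤ γ

/-- The sequence `(N⁻¹ max{xᵢ, 0})ᵢ`, with `xᵢ = 0` for `i` out of range
(coordinates are numbered from `0`). -/
def scaledPosPart {N : ℕ} (x : Fin N → ℝ) (i : ℕ) : ℝ :=
  if h : i < N then (N : ℝ)⁻¹ * max (x ⟨i, h⟩) 0 else 0

theorem scaledPosPart_nonneg {N : ℕ} (x : Fin N → ℝ) (i : ℕ) : 0 ≤ scaledPosPart x i := by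
  unfold scaledPosPart
  split_ifs <;> positivity

theorem scaledPosPart_antitone {N : ℕ} {x : Fin N → ℝ} (hx : Antitone x) :
    Antitone (scaledPosPart x) := by
  intro i j hij
  by_cases hj : j < N
  · have hi : i < N := hij.trans_lt hj
    simp only [scaledPosPart, hi, hj, dif_pos]
    have : x ⟨j, hj⟩ ≤ x ⟨i, hi⟩ := hx hij
    gcongr
  · have : scaledPosPart x j = 0 := by simp [scaledPosPart, hj]
    rw [this]
    exact scaledPosPart_nonneg x i

theorem hasSum_scaledPosPart {N : ℕ} (x : Fin N → ℝ) (p : ℕ) (hp : p ≠ 0) :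
    HasSum (fun i => scaledPosPart x i ^ p) (∑ i, ((N : ℝ)⁻¹ * max (x i) 0) ^ p) := by
  have h : ∑ i, ((N : ℝ)⁻¹ * max (x i) 0) ^ p
      = ∑ i ∈ Finset.range N, scaledPosPart x i ^ p := by
    rw [← Fin.sum_univ_eq_sum_range (fun i => scaledPosPart x i ^ p)]
    exact Finset.sum_congr rfl fun i _ => by simp [scaledPosPart]
  rw [h]
  refine hasSum_sum_of_ne_finset_zero fun i hi => ?_
  have : ¬ i < N := by simpa using hi
  simp [scaledPosPart, this, hp]

/-- `i ↦ -x_{N+1-i}` (in the numbering `1, …, N`). -/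
def negRev {N : ℕ} (x : Fin N → ℝ) (i : Fin N) : ℝ := -x i.rev

theorem negRev_antitone {N : ℕ} {x : Fin N → ℝ} (hx : Antitone x) : Antitone (negRev x) :=
  fun _ _ hij => neg_le_neg (hx (Fin.rev_le_rev.2 hij))

/-- The embedding `x ↦ ω(x)` of `𝕎_N` into `Ω`. -/
def embed {N : ℕ} (x : WeylChamber N) : Omega where
  xp := ⟨scaledPosPart x.1, scaledPosPart_antitone x.2, scaledPosPart_nonneg _⟩
  xm := ⟨scaledPosPart (negRev x.1), scaledPosPart_antitone (negRev_antitone x.2),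
    scaledPosPart_nonneg _⟩
  γ := (N : ℝ)⁻¹ * ∑ i, x.1 i
  δ := ((N : ℝ) ^ 2)⁻¹ * ∑ i, x.1 i ^ 2
  δ_nonneg := by positivity
  summable_xp := (hasSum_scaledPosPart _ 2 two_ne_zero).summable
  summable_xm := (hasSum_scaledPosPart _ 2 two_ne_zero).summable
  sum_le := by
    rw [(hasSum_scaledPosPart _ 2 two_ne_zero).tsum_eq,
      (hasSum_scaledPosPart _ 2 two_ne_zero).tsum_eq]
    have h : ∑ i, ((N : ℝ)⁻¹ * max (negRev x.1 i) 0) ^ 2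
        = ∑ i, ((N : ℝ)⁻¹ * max (-x.1 i) 0) ^ 2 :=
      Fintype.sum_equiv Fin.revPerm _ _ fun i => rfl
    rw [h, ← Finset.sum_add_distrib, Finset.mul_sum]
    refine Finset.sum_le_sum fun i _ => le_of_eq ?_
    rw [mul_pow, mul_pow, ← mul_add, inv_pow]
    congr 1
    rcases le_total (x.1 i) 0 with hi | hi
    · rw [max_eq_right hi, max_eq_left (neg_nonneg.2 hi)]; ring
    · rw [max_eq_left hi, max_eq_right (neg_nonpos.2 hi)]; ring

/-- The sequence `(N⁻¹ xᵢ)ᵢ`, with `xᵢ = 0` for `i` out of range. -/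
def scaled {N : ℕ} (x : Fin N → ℝ) (i : ℕ) : ℝ :=
  if h : i < N then (N : ℝ)⁻¹ * x ⟨i, h⟩ else 0

theorem scaled_eq {N : ℕ} (x : PosWeylChamber N) : scaled x.1.1 = scaledPosPart x.1.1 := by
  ext i
  unfold scaled scaledPosPart
  split_ifs with h
  · rw [max_eq_left (x.2 _)]
  · rfl

/-- The embedding `x ↦ ω(x)` of `𝕎_{N,+}` into `Ω₊`. -/
def embedPos {N : ℕ} (x : PosWeylChamber N) : OmegaPos where
  x := ⟨scaled x.1.1, by
    rw [scaled_eq]; exact ⟨scaledPosPart_antitone x.1.2, scaledPosPart_nonneg _⟩⟩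
  γ := (N : ℝ)⁻¹ * ∑ i, x.1.1 i
  γ_nonneg := mul_nonneg (by positivity) (Finset.sum_nonneg fun i _ => x.2 i)
  summable_x := by
    have := (hasSum_scaledPosPart x.1.1 1 one_ne_zero).summable
    simpa [scaled_eq] using this
  sum_le := by
    have h := (hasSum_scaledPosPart x.1.1 1 one_ne_zero).tsum_eq
    simp only [pow_one] at h
    simp only [scaled_eq, h, Finset.mul_sum]
    exact Finset.sum_le_sum fun i _ => by rw [max_eq_left (x.2 i)]

/-! ### The Gaussian randomness and the infinite random matrices `A_ω` -/

/-- The standard complex Gaussian law: independent real and imaginary parts,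
centred of variance `1/2`. -/
def complexGaussian : Measure ℂ :=
  ((gaussianReal 0 (1 / 2)).prod (gaussianReal 0 (1 / 2))).map fun p => (p.1 : ℂ) + p.2 * Complex.I

/-- A sample of the randomness: real numbers `g i j` used to build the matrix `G`, and the complex
vectors `ξ j` and `ζ j`, whose `i`-th coordinates are `ξ j i` and `ζ j i`. -/
structure Noise where
  g : ℕ → ℕ → ℝ
  ξ : ℕ → ℕ → ℂ
  ζ : ℕ → ℕ → ℂ

/-- The sigma-algebra generated by all coordinates. -/
instance : MeasurableSpace Noise :=
  MeasurableSpace.comap (fun s : Noise => (s.g, s.ξ, s.ζ)) inferInstance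

/-- The law under which all coordinates are independent, those of `g` are standard real Gaussian,
and those of `ξ` and `ζ` are standard complex Gaussian. -/
def noiseLaw : Measure Noise :=
  ((Measure.infinitePi fun _ : ℕ => Measure.infinitePi fun _ : ℕ => gaussianReal 0 1).prod
    ((Measure.infinitePi fun _ : ℕ => Measure.infinitePi fun _ : ℕ => complexGaussian).prod
      (Measure.infinitePi fun _ : ℕ => Measure.infinitePi fun _ : ℕ => complexGaussian))).map
    fun p => ⟨p.1, p.2.1, p.2.2⟩

instance : IsProbabilityMeasure complexGaussian := by
  unfold complexGaussian
  exact Measure.isProbabilityMeasure_map (by fun_prop)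

instance : IsProbabilityMeasure noiseLaw := by
  unfold noiseLaw
  exact Measure.isProbabilityMeasure_map
    (measurable_comap_iff.2 (by exact measurable_id)).aemeasurable

/-- The infinite Gaussian Hermitian matrix: the diagonal entries are `𝒩(0,1)`, and the real and
imaginary parts of the entries above the diagonal are `𝒩(0,1/2)`, all independent. -/
def gaussianMatrix (s : Noise) : Matrix ℕ ℕ ℂ := Matrix.of fun i j =>
  if i = j then (s.g i i : ℂ)
  else if i < j then ((s.g i j : ℂ) + s.g j i * Complex.I) / (√2 : ℝ)
  else ((s.g j i : ℂ) - s.g i j * Complex.I) / (√2 : ℝ)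

/-- The sum `∑_{j ≥ 0} u j` in the sense of the limit of the partial sums `∑_{j < n} u j`
(and `0` if this limit does not exist). -/
def seriesLim (u : ℕ → ℂ) : ℂ :=
  open Classical in
  if ∃ l, Tendsto (fun n => ∑ j ∈ Finset.range n, u j) atTop (𝓝 l)
  then limUnder atTop (fun n => ∑ j ∈ Finset.range n, u j) else 0

/-- Entrywise sum of a series of infinite matrices. -/
def matrixSeries (M : ℕ → Matrix ℕ ℕ ℂ) : Matrix ℕ ℕ ℂ :=
  Matrix.of fun i k => seriesLim fun j => M j i k

/-- The rank one matrix `v v†`. -/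
def outer (v : ℕ → ℂ) : Matrix ℕ ℕ ℂ := Matrix.vecMulVec v (star v)

/-- The infinite random matrix
`A_ω = γ I + √(δ - ∑ ((x⁺ᵢ)² + (x⁻ᵢ)²)) G + ∑ x⁺ⱼ (ξ(j)ξ(j)† - I) - ∑ x⁻ⱼ (ζ(j)ζ(j)† - I)`,
for `ω ∈ Ω`. The series converge almost surely (as limits of partial sums). -/
def infiniteMatrix (ω : Omega) (s : Noise) : Matrix ℕ ℕ ℂ :=
  (ω.γ : ℂ) • (1 : Matrix ℕ ℕ ℂ)
    + (√(ω.δ - ∑' i, (ω.xp.1 i ^ 2 + ω.xm.1 i ^ 2)) : ℂ) • gaussianMatrix s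
    + matrixSeries (fun j => (ω.xp.1 j : ℂ) • (outer (s.ξ j) - 1))
    - matrixSeries (fun j => (ω.xm.1 j : ℂ) • (outer (s.ζ j) - 1))

/-- The infinite random matrix `A_ω = (γ - ∑ xⱼ) I + ∑ xⱼ ξ(j)ξ(j)†`, for `ω ∈ Ω₊`. -/
def infiniteMatrixPos (ω : OmegaPos) (s : Noise) : Matrix ℕ ℕ ℂ :=
  ((ω.γ - ∑' j, ω.x.1 j : ℝ) : ℂ) • (1 : Matrix ℕ ℕ ℂ)
    + matrixSeries (fun j => (ω.x.1 j : ℂ) • outer (s.ξ j))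

theorem isHermitian_gaussianMatrix (s : Noise) : (gaussianMatrix s).IsHermitian := by
  ext i j
  rcases lt_trichotomy i j with h | h | h
  · simp [gaussianMatrix, h, h.ne, h.ne', h.not_gt, sub_eq_add_neg]
  · simp [gaussianMatrix, h]
  · simp [gaussianMatrix, h, h.ne, h.ne', h.not_gt, sub_eq_add_neg]

theorem star_seriesLim (u : ℕ → ℂ) : star (seriesLim u) = seriesLim fun j => star (u j) := by
  have key : ∀ (v : ℕ → ℂ) (l : ℂ),
      Tendsto (fun n => ∑ j ∈ Finset.range n, v j) atTop (𝓝 l) →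
      Tendsto (fun n => ∑ j ∈ Finset.range n, star (v j)) atTop (𝓝 (star l)) := by
    intro v l hl
    have := (continuous_star.tendsto l).comp hl
    simpa [Function.comp_def, star_sum] using this
  by_cases h : ∃ l, Tendsto (fun n => ∑ j ∈ Finset.range n, u j) atTop (𝓝 l)
  · obtain ⟨l, hl⟩ := h
    have hl' := key u l hl
    rw [seriesLim, seriesLim, if_pos ⟨l, hl⟩, if_pos ⟨_, hl'⟩, hl.limUnder_eq, hl'.limUnder_eq]
  · have h' : ¬ ∃ l, Tendsto (fun n => ∑ j ∈ Finset.range n, star (u j)) atTop (𝓝 l) := by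
      rintro ⟨l, hl⟩
      exact h ⟨star l, by simpa using key _ l hl⟩
    rw [seriesLim, seriesLim, if_neg h, if_neg h', star_zero]

theorem isHermitian_matrixSeries {M : ℕ → Matrix ℕ ℕ ℂ} (hM : ∀ j, (M j).IsHermitian) :
    (matrixSeries M).IsHermitian := by
  ext i k
  simp only [Matrix.conjTranspose_apply, matrixSeries, Matrix.of_apply, star_seriesLim,
    (hM _).apply]

theorem isHermitian_outer (v : ℕ → ℂ) : (outer v).IsHermitian := by
  ext i k
  simp [outer, Matrix.vecMulVec_apply, mul_comm]

theorem isHermitian_smul {M : Matrix ℕ ℕ ℂ} (hM : M.IsHermitian) (c : ℝ) :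
    ((c : ℂ) • M).IsHermitian := by
  ext i k
  simp [hM.apply i k]

theorem isHermitian_infiniteMatrix (ω : Omega) (s : Noise) :
    (infiniteMatrix ω s).IsHermitian :=
  (((isHermitian_smul Matrix.isHermitian_one _).add
    (isHermitian_smul (isHermitian_gaussianMatrix s) _)).add
    (isHermitian_matrixSeries fun _ =>
      isHermitian_smul ((isHermitian_outer _).sub Matrix.isHermitian_one) _)).sub
    (isHermitian_matrixSeries fun _ =>
      isHermitian_smul ((isHermitian_outer _).sub Matrix.isHermitian_one) _)

theorem isHermitian_infiniteMatrixPos (ω : OmegaPos) (s : Noise) :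
    (infiniteMatrixPos ω s).IsHermitian :=
  (isHermitian_smul Matrix.isHermitian_one _).add
    (isHermitian_matrixSeries fun _ => isHermitian_smul (isHermitian_outer _) _)

/-- The map `Π_K^∞`: top-left `K × K` corner of an infinite Hermitian matrix. -/
def infCorner (K : ℕ) (A : Matrix ℕ ℕ ℂ) (hA : A.IsHermitian) : HermitianMatrix K :=
  ⟨A.submatrix Fin.val Fin.val, hA.submatrix _⟩

/-- The boundary kernel `Λ_K^∞(ω, ·) = Law [eval_K (Π_K^∞ (A_ω))]`, for `ω ∈ Ω`. -/
def boundaryKernel (K : ℕ) (ω : Omega) : Measure (WeylChamber K) :=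
  noiseLaw.map fun s => eval K (infCorner K (infiniteMatrix ω s) (isHermitian_infiniteMatrix ω s))

/-- The boundary kernel `Λ_K^∞(ω, ·) = Law [eval_K (Π_K^∞ (A_ω))]`, for `ω ∈ Ω₊`. -/
def boundaryKernelPos (K : ℕ) (ω : OmegaPos) : Measure (WeylChamber K) :=
  noiseLaw.map fun s =>
    eval K (infCorner K (infiniteMatrixPos ω s) (isHermitian_infiniteMatrixPos ω s))

/-! ### Measurability: the laws above are genuine push-forwards -/

theorem measurable_noise : Measurable fun s : Noise => (s.g, s.ξ, s.ζ) :=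
  comap_measurable _

theorem measurable_g (i j : ℕ) : Measurable fun s : Noise => s.g i j :=
  (measurable_pi_apply j).comp ((measurable_pi_apply i).comp measurable_noise.fst)

theorem measurable_ξ (i j : ℕ) : Measurable fun s : Noise => s.ξ i j :=
  (measurable_pi_apply j).comp ((measurable_pi_apply i).comp measurable_noise.snd.fst)

theorem measurable_ζ (i j : ℕ) : Measurable fun s : Noise => s.ζ i j :=
  (measurable_pi_apply j).comp ((measurable_pi_apply i).comp measurable_noise.snd.snd)

theorem measurable_seriesLim {u : ℕ → Noise → ℂ} (hu : ∀ j, Measurable (u j)) :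
    Measurable fun s => seriesLim fun j => u j s := by
  have hs : ∀ n, Measurable fun s => ∑ j ∈ Finset.range n, u j s := fun n =>
    Finset.measurable_sum _ fun j _ => hu j
  exact Measurable.ite (measurableSet_exists_tendsto hs)
    (StronglyMeasurable.limUnder fun n => (hs n).stronglyMeasurable).measurable measurable_const

theorem measurable_gaussianMatrix (i j : ℕ) : Measurable fun s => gaussianMatrix s i j := by
  have h : ∀ i j, Measurable fun s : Noise => (s.g i j : ℂ) := fun i j =>
    Complex.measurable_ofReal.comp (measurable_g i j)
  simp only [gaussianMatrix, Matrix.of_apply]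
  split_ifs
  · exact h i i
  · exact ((h i j).add ((h j i).mul_const _)).div_const _
  · exact ((h j i).sub ((h i j).mul_const _)).div_const _

theorem measurable_outer {v : Noise → ℕ → ℂ} (hv : ∀ i, Measurable fun s => v s i) (i j : ℕ) :
    Measurable fun s => outer (v s) i j := by
  simp only [outer, Matrix.vecMulVec_apply, Pi.star_apply]
  exact (hv i).mul (continuous_star.measurable.comp (hv j))

theorem measurable_infiniteMatrix (ω : Omega) (i k : ℕ) :
    Measurable fun s => infiniteMatrix ω s i k :=
  ((measurable_const.add ((measurable_gaussianMatrix i k).const_mul _)).add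
    (measurable_seriesLim fun j =>
      ((measurable_outer (measurable_ξ j) i k).sub_const _).const_mul _)).sub
    (measurable_seriesLim fun j =>
      ((measurable_outer (measurable_ζ j) i k).sub_const _).const_mul _)

theorem measurable_infiniteMatrixPos (ω : OmegaPos) (i k : ℕ) :
    Measurable fun s => infiniteMatrixPos ω s i k :=
  measurable_const.add
    (measurable_seriesLim fun j => (measurable_outer (measurable_ξ j) i k).const_mul _)

theorem measurable_infCorner (K : ℕ) {A : Noise → Matrix ℕ ℕ ℂ} (hA : ∀ s, (A s).IsHermitian)
    (hm : ∀ i k, Measurable fun s => A s i k) :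
    Measurable fun s => eval K (infCorner K (A s) (hA s)) :=
  (measurable_eval K).comp (measurable_comap_iff.2
    (measurable_pi_iff.2 fun i => measurable_pi_iff.2 fun k => hm i k))

instance (K : ℕ) (ω : Omega) : IsProbabilityMeasure (boundaryKernel K ω) :=
  Measure.isProbabilityMeasure_map
    (measurable_infCorner K _ (measurable_infiniteMatrix ω)).aemeasurable

instance (K : ℕ) (ω : OmegaPos) : IsProbabilityMeasure (boundaryKernelPos K ω) :=
  Measure.isProbabilityMeasure_map
    (measurable_infCorner K _ (measurable_infiniteMatrixPos ω)).aemeasurable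

/-! ### Symmetric extension -/

/-- The symmetric extension to `ℝ^K` of a measure on `𝕎_K`: the sum over all permutations of the
coordinates of its images. It has total mass `K!` times that of `μ`. -/
def symExt {K : ℕ} (μ : Measure (WeylChamber K)) : Measure (Fin K → ℝ) :=
  ∑ σ : Equiv.Perm (Fin K), μ.map fun y i => y.1 (σ i)

end CornerKernels

end

open CornerKernels

/-! At an embedded point the inequality defining `Ω` is an equality, so the Gaussian matrix drops
out, and the term `γ I` cancels the compensators `-I` of the two series. The corner of the boundary
matrix is then `M diag(x/N) M†`, where `M` is `K × N` with i.i.d. standard complex Gaussian entries,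
whatever the signs of `x` (`boundaryKernel_embed`). On `Ω₊` the same matrix appears, so both cases
are one. On the finite side, the composed kernel is the law of the eigenvalues of `P U diag(x) U†
P†`, with `U` Haar on `𝕌(N)` and `P` the projection on the first `K` coordinates
(`cornerKernel_apply`). Thus `M/√N` has to be compared with `P U`.

The law of `M` is invariant under right multiplication by unitaries, so `M` may be replaced by `M U`
with `U` Haar and independent of `M`. If `M M†/N` is close to `I`, the polar decomposition reads
`M/√N = S P W` with `S = (M M†/N)^{1/2}` and `W` unitary (`exists_polar`), and left invariance of
Haar measure absorbs `W` into `U`. For such a fixed `M` the boundary matrix is therefore `S B S†`,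
where `B = P U diag(x) U† P†` is exactly the finite random corner.

The matrix `S` does not involve `x`, and the law of large numbers gives `S → I` in probability
(`tendsto_gaussianMatrixLaw_bad`). Uniformity over the unbounded range of `x` comes from the test
function: composed with the eigenvalue map it is continuous with compact support, so replacing `B`
by `S B S†` changes it little, uniformly in all Hermitian `B` (`abs_sub_congrH_le`). The exceptional
event costs at most twice the sup norm times its probability. -/

noncomputable section

namespace CornerKernels

/-! ### Congruences of Hermitian matrices and their eigenvalues -/

/-- The congruence `A ↦ M A M†` on Hermitian matrices. -/
def congrH {K N : ℕ} (M : Matrix (Fin K) (Fin N) ℂ) (A : HermitianMatrix N) : HermitianMatrix K :=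
  ⟨M * A.1 * Mᴴ, Matrix.isHermitian_mul_mul_conjTranspose _ A.2⟩

/-- The real diagonal matrix with diagonal `d`, as a Hermitian matrix. -/
def diagH {N : ℕ} (d : Fin N → ℝ) : HermitianMatrix N :=
  ⟨Matrix.diagonal fun i => (d i : ℂ), Matrix.isHermitian_diagonal_of_self_adjoint _ (by
    ext i; simp)⟩

theorem congrH_congrH {K L N : ℕ} (M : Matrix (Fin K) (Fin L) ℂ) (M' : Matrix (Fin L) (Fin N) ℂ)
    (A : HermitianMatrix N) : congrH M (congrH M' A) = congrH (M * M') A :=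
  Subtype.ext (by simp [congrH, Matrix.mul_assoc])

theorem conjDiag_eq (N : ℕ) (U : Matrix.unitaryGroup (Fin N) ℂ) (x : WeylChamber N) :
    conjDiag N U x = congrH U.1 (diagH x.1) := rfl

/-- Conjugation by `U` fixes scalar matrices and determinants, hence the characteristic polynomial
at every integer, and these values determine the ordered eigenvalues. -/
theorem eval_congrH_unitary {N : ℕ} (U : Matrix.unitaryGroup (Fin N) ℂ) (A : HermitianMatrix N) :
    eval N (congrH U.1 A) = eval N A := by
  refine injective_monicValues N (funext fun t => ?_)
  have hU : U.1 * U.1ᴴ = 1 := (Matrix.mem_unitaryGroup_iff).1 U.2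
  have h : Matrix.scalar (Fin N) (t : ℂ) - (congrH U.1 A).1
      = U.1 * (Matrix.scalar (Fin N) (t : ℂ) - A.1) * U.1ᴴ := by
    have hs : U.1 * Matrix.scalar (Fin N) (t : ℂ) * U.1ᴴ = Matrix.scalar (Fin N) (t : ℂ) := by
      rw [← (Matrix.scalar_commute (t : ℂ) (fun _ => mul_comm _ _) U.1).eq, mul_assoc, hU, mul_one]
    rw [mul_sub, sub_mul, hs]
    rfl
  rw [monicValues_eval, monicValues_eval, h, Matrix.det_mul, Matrix.det_mul, mul_right_comm,
    ← Matrix.det_mul, hU, Matrix.det_one, one_mul]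

theorem eval_diagH {N : ℕ} (x : WeylChamber N) : eval N (diagH x.1) = x := by
  refine injective_monicValues N (funext fun t => ?_)
  rw [monicValues_eval, diagH, Matrix.scalar_apply, Matrix.diagonal_sub,
    Matrix.det_diagonal, monicValues, ← Complex.ofReal_re (∏ i, ((t : ℝ) - x.1 i))]
  push_cast
  rfl

theorem exists_eq_congrH_diagH_eval {N : ℕ} (A : HermitianMatrix N) :
    ∃ Q : Matrix.unitaryGroup (Fin N) ℂ, A = congrH Q.1 (diagH (eval N A).1) := by
  -- The spectral theorem indexes eigenvalues through an arbitrary equivalence, `eval` lists them in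
  -- order. `σ` reconciles the two, and `Q` is the eigenvector matrix with columns permuted by `σ`.
  obtain ⟨σ, hσ⟩ : ∃ σ : Equiv.Perm (Fin N), ∀ i, A.2.eigenvalues (σ i) = (eval N A).1 i := by
    refine ⟨(finCongr (Fintype.card_fin N).symm).trans
      (Fintype.equivOfCardEq (Fintype.card_fin _)), fun i => ?_⟩
    simp [Matrix.IsHermitian.eigenvalues, eval]
  have hs := A.2.spectral_theorem
  rw [Unitary.conjStarAlgAut_apply] at hs
  set E := A.2.eigenvectorUnitary
  have hE : E.1ᴴ * E.1 = 1 := Matrix.mem_unitaryGroup_iff'.1 E.2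
  refine ⟨⟨E.1.submatrix id σ, Matrix.mem_unitaryGroup_iff'.2 ?_⟩, Subtype.ext ?_⟩
  · rw [Matrix.star_eq_conjTranspose, Matrix.conjTranspose_submatrix,
      ← Matrix.submatrix_mul _ _ _ _ _ Function.bijective_id, hE, Matrix.submatrix_one_equiv]
  · have hd : (diagH (eval N A).1).1
        = (Matrix.diagonal (RCLike.ofReal ∘ A.2.eigenvalues) : Matrix _ _ ℂ).submatrix σ σ := by
      rw [Matrix.submatrix_diagonal_equiv]
      simp only [diagH, ← hσ]
      rfl
    refine hs.trans ?_
    simp only [congrH, hd, Matrix.conjTranspose_submatrix]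
    rw [← Matrix.submatrix_mul _ _ _ _ _ σ.bijective, ← Matrix.submatrix_mul _ _ _ _ _ σ.bijective]
    rfl

/-! ### Operator norm and continuity of the ordered eigenvalues -/

section Norm

open scoped Matrix.Norms.L2Operator

theorem norm_eq_norm_eval {N : ℕ} (A : HermitianMatrix N) : ‖A.1‖ = ‖(eval N A).1‖ := by
  obtain ⟨Q, hQ⟩ := exists_eq_congrH_diagH_eval A
  have h : A.1 = Q.1 * (diagH (eval N A).1).1 * (star Q).1 := congrArg Subtype.val hQ
  conv_lhs => rw [h]
  rw [CStarRing.norm_mul_coe_unitary, CStarRing.norm_coe_unitary_mul]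
  simp only [diagH, Matrix.l2_opNorm_diagonal]
  simp [Pi.norm_def]

theorem isCompact_weylChamber_norm_le (N : ℕ) (R : ℝ) :
    IsCompact {x : WeylChamber N | ‖x.1‖ ≤ R} := by
  have hc : IsClosed {x : Fin N → ℝ | Antitone x} := by
    simp only [Antitone, Set.ofPred_forall]
    exact isClosed_iInter fun i => isClosed_iInter fun j => isClosed_iInter fun _ =>
      isClosed_le (continuous_apply j) (continuous_apply i)
  have := hc.isClosedEmbedding_subtypeVal.isCompact_preimage
    (isCompact_closedBall (0 : Fin N → ℝ) R)
  convert! this using 1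
  ext x
  simp

/-- Near `A` the spectra stay in a compact set. Values of the characteristic polynomial depend
continuously on the matrix, so every cluster point of the spectra has the same values as the
spectrum of `A`, and equals it by injectivity of `monicValues`. -/
theorem continuous_eval (N : ℕ) : Continuous (eval N) := by
  refine continuous_iff_continuousAt.2 fun A => ?_
  have hn : Continuous fun B : HermitianMatrix N => ‖B.1‖ :=
    continuous_norm.comp continuous_subtype_val
  have hm : Continuous fun B : HermitianMatrix N => monicValues N (eval N B) := by
    refine continuous_pi fun t => ?_
    simp only [monicValues_eval]
    exact Complex.continuous_re.comp (continuous_const.sub continuous_subtype_val).matrix_det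
  refine (isCompact_weylChamber_norm_le N (‖A.1‖ + 1)).tendsto_nhds_of_unique_mapClusterPt
    ?_ fun y _ hy => ?_
  · filter_upwards [hn.continuousAt.eventually (gt_mem_nhds (lt_add_one ‖A.1‖))] with B hB
    exact (norm_eq_norm_eval B).symm.trans_le hB.le
  · have h := hy.tendsto_comp ((continuous_monicValues N).tendsto y)
    refine injective_monicValues N ?_
    have : (𝓝 (monicValues N y) ⊓ map (monicValues N ∘ eval N) (𝓝 A)).NeBot := h
    exact eq_of_nhds_neBot (this.mono (inf_le_inf_left _ (hm.tendsto A)))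

/-- A continuous function of the eigenvalues that vanishes for large eigenvalues is uniformly
insensitive to congruences close to the identity. -/
theorem abs_sub_congrH_le {K : ℕ} {f : WeylChamber K → ℝ} (hf : Continuous f) {R : ℝ}
    (hR : ∀ y, f y ≠ 0 → ‖y.1‖ ≤ R) {ε : ℝ} (hε : 0 < ε) :
    ∃ η : ℝ, 0 < η ∧ η < 1 ∧ ∀ (S : Matrix (Fin K) (Fin K) ℂ), ‖S - 1‖ ≤ η →
      ∀ B : HermitianMatrix K, |f (eval K (congrH S B)) - f (eval K B)| ≤ ε := by
  have hcl : IsClosedEmbedding (Subtype.val : HermitianMatrix K → Matrix (Fin K) (Fin K) ℂ) := by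
    refine (isClosed_eq (Continuous.matrix_conjTranspose continuous_id)
      continuous_id).isClosedEmbedding_subtypeVal
  have hF : Continuous fun B => f (eval K B) := hf.comp (continuous_eval K)
  have : ProperSpace (Matrix (Fin K) (Fin K) ℂ) := FiniteDimensional.proper ℂ _
  have hcomp : HasCompactSupport fun B => f (eval K B) := by
    refine HasCompactSupport.intro (hcl.isCompact_preimage (isCompact_closedBall 0 R))
      fun B hB => ?_
    by_contra h
    exact hB (by simpa [norm_eq_norm_eval] using hR _ h)
  obtain ⟨δ, hδ, hu⟩ := Metric.uniformContinuous_iff.1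
    (hcomp.uniformContinuous_of_continuous hF) ε hε
  -- `R` may be zero or negative; a positive radius is needed to divide by.
  obtain ⟨R', hR', hRR'⟩ : ∃ R', 0 < R' ∧ R ≤ R' := ⟨max R 1, by positivity, le_max_left _ _⟩
  -- The bound `1/8` gives `‖B‖ ≤ 2R'` below; then `3‖S - 1‖‖B‖ ≤ 6‖S - 1‖R'`, which the second
  -- bound keeps under `δ`.
  refine ⟨min (1 / 8) (δ / (8 * R')), by positivity, (min_le_left _ _).trans_lt (by norm_num),
    fun S hS B => ?_⟩
  have h1 : ‖S - 1‖ ≤ 1 / 8 := hS.trans (min_le_left _ _)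
  have h2 : ‖S - 1‖ * (8 * R') ≤ δ := by
    rw [← le_div_iff₀ (by positivity)]
    exact hS.trans (min_le_right _ _)
  have hd : ‖(congrH S B).1 - B.1‖ ≤ 3 * ‖S - 1‖ * ‖B.1‖ := by
    have he : (congrH S B).1 - B.1
        = (S - 1) * B.1 * (S - 1)ᴴ + (S - 1) * B.1 + B.1 * (S - 1)ᴴ := by
      simp only [congrH, Matrix.conjTranspose_sub, Matrix.conjTranspose_one]
      noncomm_ring
    have hs : ‖(S - 1)ᴴ‖ = ‖S - 1‖ := Matrix.l2_opNorm_conjTranspose _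
    rw [he]
    have ha := norm_mul_le ((S - 1) * B.1) (S - 1)ᴴ
    have hb := norm_mul_le (S - 1) B.1
    have hc := norm_mul_le B.1 (S - 1)ᴴ
    rw [hs] at ha hc
    have h0 : 0 ≤ ‖S - 1‖ := norm_nonneg _
    have h0' : 0 ≤ ‖B.1‖ := norm_nonneg _
    have h3 : ‖(S - 1) * B.1‖ * ‖S - 1‖ ≤ ‖S - 1‖ * ‖B.1‖ :=
      (mul_le_of_le_one_right (norm_nonneg _) (h1.trans (by norm_num))).trans hb
    have h4 := norm_add₃_le (a := (S - 1) * B.1 * (S - 1)ᴴ) (b := (S - 1) * B.1)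
      (c := B.1 * (S - 1)ᴴ)
    nlinarith
  by_cases h0 : f (eval K (congrH S B)) = 0 ∧ f (eval K B) = 0
  · rw [h0.1, h0.2]
    simpa using hε.le
  -- One of the two values is nonzero. If only that of `S B S†` is, then `‖B‖ ≤ R' + (3/8)‖B‖`,
  -- which still gives `‖B‖ ≤ 2R'`.
  have hB : ‖B.1‖ ≤ 2 * R' := by
    by_cases hB0 : f (eval K B) = 0
    · have h5 := hR _ fun h => h0 ⟨h, hB0⟩
      rw [← norm_eq_norm_eval] at h5
      have h6 := norm_sub_norm_le B.1 (congrH S B).1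
      rw [norm_sub_rev] at h6
      have h7 : 3 * ‖S - 1‖ * ‖B.1‖ ≤ 3 * (1 / 8) * ‖B.1‖ := by gcongr
      linarith
    · have h5 := hR _ hB0
      rw [← norm_eq_norm_eval] at h5
      linarith
  refine (hu ?_).le
  rw [Subtype.dist_eq, dist_eq_norm]
  by_cases hS0 : ‖S - 1‖ = 0
  · exact hd.trans_lt (by simpa [hS0] using hδ)
  have h0 : 0 < ‖S - 1‖ := lt_of_le_of_ne (norm_nonneg _) (Ne.symm hS0)
  have h6 : ‖S - 1‖ * ‖B.1‖ ≤ ‖S - 1‖ * (2 * R') := by gcongr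
  nlinarith [mul_pos h0 hR']

/-! ### The polar decomposition of a rectangular matrix -/

/-- The matrix of the projection on the first `K` coordinates. -/
def topRows {K N : ℕ} (h : K ≤ N) : Matrix (Fin K) (Fin N) ℂ :=
  (1 : Matrix (Fin N) (Fin N) ℂ).submatrix (Fin.castLE h) id

theorem topRows_mul {K L N : ℕ} (h : K ≤ N) (U : Matrix (Fin N) (Fin L) ℂ) :
    topRows h * U = U.submatrix (Fin.castLE h) id := by
  rw [topRows, ← Matrix.submatrix_id_id U, ← Matrix.submatrix_mul _ _ _ _ _ Function.bijective_id,
    Matrix.one_mul]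
  rfl

/-- The rows of `V` are orthonormal; completing them to an orthonormal basis of `ℂ^N` gives the rows
of `W`. -/
theorem exists_unitary_topRows_mul {K N : ℕ} (h : K ≤ N) {V : Matrix (Fin K) (Fin N) ℂ}
    (hV : V * Vᴴ = 1) : ∃ W : Matrix.unitaryGroup (Fin N) ℂ, topRows h * W.1 = V := by
  classical
  let s : Set (Fin N) := Set.range (Fin.castLE h)
  -- The default `0` is irrelevant: orthonormality is used only on the first `K` indices.
  let v : Fin N → EuclideanSpace ℂ (Fin N) := fun i =>
    if hi : i.1 < K then WithLp.toLp 2 (V ⟨i, hi⟩) else 0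
  have hv : Orthonormal ℂ (s.domRestrict v) := by
    rw [orthonormal_iff_ite]
    rintro ⟨_, i, rfl⟩ ⟨_, j, rfl⟩
    have := congrFun (congrFun hV j) i
    rw [Matrix.mul_apply, Matrix.one_apply] at this
    simp only [Matrix.conjTranspose_apply] at this
    simp only [Set.domRestrict_apply, v, Fin.val_castLE, i.2, j.2, dif_pos, Fin.eta,
      EuclideanSpace.inner_toLp_toLp, dotProduct, Pi.star_apply, this]
    exact if_congr ⟨fun e => by subst e; rfl,
      fun e => (Fin.castLE_injective h (congrArg Subtype.val e)).symm⟩ rfl rfl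
  obtain ⟨b, hb⟩ := hv.exists_orthonormalBasis_extension_of_card_eq (by simp)
  refine ⟨⟨Matrix.of fun i j => b i j, Matrix.mem_unitaryGroup_iff.2 ?_⟩, ?_⟩
  · ext i j
    have := orthonormal_iff_ite.1 b.orthonormal j i
    rw [Matrix.mul_apply, Matrix.one_apply]
    simp only [eq_comm (a := i), ← this, PiLp.inner_apply, Matrix.star_apply, Matrix.of_apply,
      RCLike.inner_apply, RCLike.star_def]
  · rw [topRows_mul]
    ext i j
    simp [hb (Fin.castLE h i) ⟨i, rfl⟩, v]

/-- Since `η < 1`, the spectrum of `H = Z Z†` is positive. With `S = H^{1/2}`, the matrix `S⁻¹ Z`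
has orthonormal rows and so extends to a unitary. -/
theorem exists_polar {K N : ℕ} (h : K ≤ N) {Z : Matrix (Fin K) (Fin N) ℂ} {η : ℝ} (hη : η < 1)
    (hZ : ‖Z * Zᴴ - 1‖ ≤ η) : ∃ (S : Matrix (Fin K) (Fin K) ℂ) (W : Matrix.unitaryGroup (Fin N) ℂ),
      ‖S - 1‖ ≤ η ∧ Z = S * (topRows h * W.1) := by
  set H := Z * Zᴴ with hH
  have hsa : IsSelfAdjoint H := Matrix.isHermitian_mul_conjTranspose_self Z
  have hη0 : 0 ≤ η := (norm_nonneg _).trans hZ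
  have hspec : ∀ x ∈ spectrum ℝ H, |x - 1| ≤ η := by
    have : cfc (fun x : ℝ => x - 1) H = H - 1 := by
      rw [cfc_sub (fun x : ℝ => x) (fun _ => (1 : ℝ)) H, cfc_id' ℝ H, cfc_const_one ℝ H]
    rw [← this] at hZ
    exact (norm_cfc_le_iff (fun x : ℝ => x - 1) H hη0).1 hZ
  have hpos : ∀ x ∈ spectrum ℝ H, 0 < x := fun x hx => by
    linarith [(abs_le.1 (hspec x hx)).1]
  have hci : ContinuousOn (fun x : ℝ => (√x)⁻¹) (spectrum ℝ H) :=
    Real.continuous_sqrt.continuousOn.inv₀ fun x hx => (Real.sqrt_pos.2 (hpos x hx)).ne'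
  set S := cfc (fun x : ℝ => √x) H with hS
  set T := cfc (fun x : ℝ => (√x)⁻¹) H with hT
  have hST : S * T = 1 := by
    rw [hS, hT, ← cfc_mul (fun x : ℝ => √x) (fun x : ℝ => (√x)⁻¹) H
      Real.continuous_sqrt.continuousOn hci, ← cfc_const_one ℝ H]
    exact cfc_congr fun x hx => mul_inv_cancel₀ (Real.sqrt_pos.2 (hpos x hx)).ne'
  have hTH : T * H * T = 1 := by
    have h1 : T * cfc (fun x : ℝ => x) H = S := by
      rw [hT, ← cfc_mul (fun x : ℝ => (√x)⁻¹) (fun x : ℝ => x) H hci]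
      refine cfc_congr fun x hx => ?_
      have := Real.sqrt_pos.2 (hpos x hx)
      have h2 := Real.mul_self_sqrt (hpos x hx).le
      field_simp
      linarith
    rw [cfc_id' ℝ H] at h1
    rw [h1, hST]
  have hTs : Tᴴ = T := cfc_predicate (fun x : ℝ => (√x)⁻¹) H
  obtain ⟨W, hW⟩ := exists_unitary_topRows_mul h (V := T * Z) (by
    rw [Matrix.conjTranspose_mul, hTs, ← hTH, hH]
    simp only [Matrix.mul_assoc])
  refine ⟨S, W, ?_, ?_⟩
  · have : S - 1 = cfc (fun x : ℝ => √x - 1) H := by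
      rw [cfc_sub (fun x : ℝ => √x) (fun _ => (1 : ℝ)) H, cfc_const_one ℝ H]
    rw [this]
    -- `|√x - 1| ≤ |√x - 1| (√x + 1) = |x - 1|`, so `S` is as close to `1` as `H` is.
    refine norm_cfc_le hη0 fun x hx => le_trans ?_ (hspec x hx)
    have h2 := Real.mul_self_sqrt (hpos x hx).le
    have h3 := Real.sqrt_nonneg x
    have : x - 1 = (√x - 1) * (√x + 1) := by linarith
    rw [Real.norm_eq_abs, this, abs_mul]
    exact le_mul_of_one_le_right (abs_nonneg _) (by rw [abs_of_pos (by linarith)]; linarith)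
  · rw [hW, ← Matrix.mul_assoc, hST, Matrix.one_mul]

end Norm

/-! ### The kernels `Λ_K^N` as laws of corners of unitary conjugates -/

instance {m n : Type*} [Countable m] [Countable n] : SecondCountableTopology (Matrix m n ℂ) :=
  inferInstanceAs (SecondCountableTopology (m → n → ℂ))

instance (N : ℕ) : SecondCountableTopology (Matrix.unitaryGroup (Fin N) ℂ) :=
  TopologicalSpace.Subtype.secondCountableTopology _

instance (N : ℕ) : (haarUnitary N).IsHaarMeasure := by
  unfold haarUnitary; infer_instance

/-- A right translate of the Haar probability measure is again a Haar probability measure, hence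
equal to it. -/
instance (N : ℕ) : (haarUnitary N).IsMulRightInvariant := by
  refine ⟨fun g => ?_⟩
  have := Measure.isProbabilityMeasure_map (μ := haarUnitary N)
    (measurable_mul_const g).aemeasurable
  exact Measure.isHaarMeasure_eq_of_isProbabilityMeasure _ _

theorem topRows_mul_topRows {K L N : ℕ} (h : K ≤ L) (h' : L ≤ N) :
    topRows h * topRows h' = topRows (h.trans h') := by
  rw [topRows_mul]
  rfl

theorem topRows_mul_conjTranspose {K N : ℕ} (h : K ≤ N) :
    (topRows h * (topRows h)ᴴ : Matrix (Fin K) (Fin K) ℂ) = 1 := by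
  rw [topRows_mul]
  ext i j
  simp [topRows, Matrix.one_apply]

theorem corner_eq_congrH (N : ℕ) (A : HermitianMatrix (N + 1)) :
    corner N A = congrH (topRows N.le_succ) A := by
  refine Subtype.ext ?_
  ext i j
  change A.1.submatrix Fin.castSucc Fin.castSucc i j
    = (topRows N.le_succ * A.1 * (topRows N.le_succ)ᴴ : Matrix (Fin N) (Fin N) ℂ) i j
  rw [topRows_mul, topRows, Matrix.conjTranspose_submatrix, Matrix.conjTranspose_one,
    Matrix.mul_apply]
  simp [Matrix.one_apply]
  rfl

theorem continuous_eval_congrH {X : Type*} [TopologicalSpace X] {K N : ℕ}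
    {f : X → Matrix (Fin K) (Fin N) ℂ} (hf : Continuous f) (A : HermitianMatrix N) :
    Continuous fun x => eval K (congrH (f x) A) := by
  have h : Continuous fun x => congrH (f x) A :=
    ((hf.matrix_mul continuous_const).matrix_mul hf.matrix_conjTranspose).subtype_mk _
  exact (continuous_eval K).comp h

theorem continuous_eval_congrH_mul {K N : ℕ} (M : Matrix (Fin K) (Fin N) ℂ)
    (A : HermitianMatrix N) :
    Continuous fun U : Matrix.unitaryGroup (Fin N) ℂ => eval K (congrH (M * U.1) A) :=
  continuous_eval_congrH (continuous_const.matrix_mul continuous_subtype_val) A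

/-- The chain of corners with fresh Haar conjugations collapses to one. In the inductive step, right
invariance of the inner Haar unitary absorbs the diagonalisation of the corner; the inner unitary
itself is then absorbed by left invariance of the outer one. -/
theorem cornerKernel_apply {K N : ℕ} (h : K ≤ N) (x : WeylChamber N) :
    cornerKernel K h x
      = (haarUnitary N).map fun U => eval K (congrH (topRows h * U.1) (diagH x.1)) := by
  induction N, h using Nat.le_induction with
  | base =>
    have h1 : topRows (le_refl K) = 1 := rfl
    have h2 : cornerKernel K (le_refl K) = Kernel.id := Nat.leRec_self _ _
    simp only [h1, Matrix.one_mul, eval_congrH_unitary, eval_diagH, h2, Kernel.id_apply,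
      Measure.map_const, measure_univ, one_smul]
  | succ N h ih =>
    have hsucc : cornerKernel K (Nat.le_succ_of_le h) = cornerKernel K h ∘ₖ link N :=
      Nat.leRec_succ _ _ h
    refine Measure.ext_of_lintegral _ fun f hf => ?_
    have hm : Measurable fun U : Matrix.unitaryGroup (Fin (N + 1)) ℂ =>
        eval N (corner N (conjDiag (N + 1) U x)) := by
      simp only [corner_eq_congrH, conjDiag_eq, congrH_congrH]
      exact (continuous_eval_congrH_mul _ _).measurable
    have hlink : link N x = (haarUnitary (N + 1)).map fun U =>
        eval N (corner N (conjDiag (N + 1) U x)) := rfl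
    have hl : ∫⁻ y, f y ∂cornerKernel K (Nat.le_succ_of_le h) x
        = ∫⁻ U, ∫⁻ y, f y ∂cornerKernel K h (eval N (corner N (conjDiag (N + 1) U x)))
          ∂haarUnitary (N + 1) := by
      rw [hsucc, Kernel.lintegral_comp _ _ _ hf, hlink]
      exact lintegral_map (hf.lintegral_kernel (κ := cornerKernel K h)) hm
    have hr : ∫⁻ y, f y ∂(haarUnitary (N + 1)).map
          (fun U => eval K (congrH (topRows (Nat.le_succ_of_le h) * U.1) (diagH x.1)))
        = ∫⁻ U : Matrix.unitaryGroup (Fin (N + 1)) ℂ,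
            f (eval K (congrH (topRows (Nat.le_succ_of_le h) * U.1) (diagH x.1)))
            ∂haarUnitary (N + 1) :=
      lintegral_map hf (continuous_eval_congrH_mul _ _).measurable
    refine hl.trans (Eq.trans ?_ hr.symm)
    have hinner : ∀ U : Matrix.unitaryGroup (Fin (N + 1)) ℂ,
        ∫⁻ y, f y ∂cornerKernel K h (eval N (corner N (conjDiag (N + 1) U x)))
          = ∫⁻ V : Matrix.unitaryGroup (Fin N) ℂ,
            f (eval K (congrH (topRows h * V.1 * topRows N.le_succ * U.1) (diagH x.1)))
            ∂haarUnitary N := fun U => by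
      -- Substituting `V Q` for `V` turns the diagonal matrix of eigenvalues back into the corner
      -- itself.
      obtain ⟨Q, hQ⟩ := exists_eq_congrH_diagH_eval (corner N (conjDiag (N + 1) U x))
      rw [ih, lintegral_map hf (continuous_eval_congrH_mul _ _).measurable,
        ← lintegral_mul_right_eq_self _ Q]
      refine lintegral_congr fun V => ?_
      rw [Submonoid.coe_mul, ← Matrix.mul_assoc, ← congrH_congrH _ Q.1, ← hQ, corner_eq_congrH,
        conjDiag_eq, congrH_congrH, congrH_congrH]
    simp only [hinner]
    rw [lintegral_lintegral_swap]
    · have hV : ∀ V : Matrix.unitaryGroup (Fin N) ℂ,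
          ∫⁻ U : Matrix.unitaryGroup (Fin (N + 1)) ℂ,
            f (eval K (congrH (topRows h * V.1 * topRows N.le_succ * U.1) (diagH x.1)))
            ∂haarUnitary (N + 1)
          = ∫⁻ U : Matrix.unitaryGroup (Fin (N + 1)) ℂ,
            f (eval K (congrH (topRows (Nat.le_succ_of_le h) * U.1) (diagH x.1)))
            ∂haarUnitary (N + 1) := fun V => by
        -- For fixed `V` the rows of `V * topRows` are orthonormal, so it is `topRows * W` with `W`
        -- unitary of size `N + 1`, and `W U` has the law of `U`.
        obtain ⟨W, hW⟩ := exists_unitary_topRows_mul N.le_succ (V := V.1 * topRows N.le_succ) (by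
          rw [Matrix.conjTranspose_mul, Matrix.mul_assoc, ← Matrix.mul_assoc (topRows _),
            topRows_mul_conjTranspose, Matrix.one_mul]
          exact Matrix.mem_unitaryGroup_iff.1 V.2)
        conv_rhs => rw [← lintegral_mul_left_eq_self _ W]
        refine lintegral_congr fun U => ?_
        rw [Submonoid.coe_mul, ← topRows_mul_topRows h N.le_succ, Matrix.mul_assoc (topRows h) V.1,
          ← hW]
        simp only [Matrix.mul_assoc]
      simp [hV]
    · refine (hf.comp (Continuous.measurable ?_)).aemeasurable
      exact continuous_eval_congrH
        (((continuous_const.matrix_mul (continuous_subtype_val.comp continuous_snd)).matrix_mul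
          continuous_const).matrix_mul (continuous_subtype_val.comp continuous_fst)) _

/-! ### Complex Gaussian matrices -/

theorem charFunDual_gaussianReal (μ : ℝ) (v : ℝ≥0) (L : StrongDual ℝ ℝ) :
    charFunDual (gaussianReal μ v) L
      = Complex.exp (L 1 * μ * Complex.I - v * (L 1 : ℂ) ^ 2 / 2) := by
  rw [← charFun_gaussianReal, charFun_apply_real, charFunDual_apply]
  congr with x
  have : L x = L 1 * x := by
    conv_lhs => rw [← mul_one x, ← smul_eq_mul, map_smul, smul_eq_mul, mul_comm]
  rw [this]
  push_cast
  rfl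

theorem charFunDual_complexGaussian (L : StrongDual ℝ ℂ) :
    charFunDual complexGaussian L
      = Complex.exp (-((L 1 ^ 2 + L Complex.I ^ 2 : ℝ) / 4 : ℂ)) := by
  have h : complexGaussian = ((gaussianReal 0 (1 / 2)).prod (gaussianReal 0 (1 / 2))).map
      (Complex.equivRealProdCLM.symm : ℝ × ℝ →L[ℝ] ℂ) := by
    unfold complexGaussian
    congr with p
    simp [Complex.equivRealProdCLM_symm_apply]
  rw [h, charFunDual_map, charFunDual_prod, charFunDual_gaussianReal, charFunDual_gaussianReal,
    ← Complex.exp_add]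
  congr 1
  simp [Complex.equivRealProdCLM_symm_apply]
  ring

theorem charFunDual_pi_complexGaussian {ι : Type*} [Fintype ι] [DecidableEq ι]
    (L : StrongDual ℝ (ι → ℂ)) :
    charFunDual (Measure.pi fun _ : ι => complexGaussian) L
      = Complex.exp (-((∑ i, (L (Pi.single i 1) ^ 2 + L (Pi.single i Complex.I) ^ 2) : ℝ)
        / 4 : ℂ)) := by
  rw [charFunDual_pi]
  simp only [charFunDual_complexGaussian, ← Complex.exp_sum]
  congr 1
  push_cast
  rw [Finset.sum_neg_distrib, Finset.sum_div]
  rfl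

/-- Real linear functionals on `ℂ^ι` are real parts of complex linear ones. -/
theorem apply_eq_re_dotProduct {ι : Type*} [Fintype ι] [DecidableEq ι]
    (L : StrongDual ℝ (ι → ℂ)) (v : ι → ℂ) :
    L v = (v ⬝ᵥ fun i => (L (Pi.single i 1) : ℂ) - L (Pi.single i Complex.I) * Complex.I).re := by
  have hv : v = ∑ i, ((v i).re • (Pi.single i 1 : ι → ℂ)
      + (v i).im • (Pi.single i Complex.I : ι → ℂ)) := by
    ext j
    simp [Finset.sum_apply, Pi.single_apply, Finset.sum_add_distrib]
  conv_lhs => rw [hv]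
  rw [dotProduct, Complex.re_sum, map_sum]
  refine Finset.sum_congr rfl fun i _ => ?_
  simp

theorem sum_normSq_mulVec_unitary {N : ℕ} (U : Matrix.unitaryGroup (Fin N) ℂ) (c : Fin N → ℂ) :
    ∑ i, Complex.normSq ((U.1 *ᵥ c) i) = ∑ i, Complex.normSq (c i) := by
  have h : ∀ d : Fin N → ℂ, ((∑ i, Complex.normSq (d i) : ℝ) : ℂ) = star d ⬝ᵥ d := fun d => by
    simp [dotProduct, Complex.normSq_eq_conj_mul_self]
  apply Complex.ofReal_injective
  rw [h, h, Matrix.star_mulVec, Matrix.dotProduct_mulVec, Matrix.vecMul_vecMul,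
    show U.1ᴴ * U.1 = 1 from Matrix.mem_unitaryGroup_iff'.1 U.2, Matrix.vecMul_one]

/-- The characteristic function at a functional with coefficient vector `c` depends only on `∑
|cᵢ|²`, and composing with `v ↦ v U` replaces `c` by `U c`. -/
theorem map_vecMul_pi_complexGaussian {N : ℕ} (U : Matrix.unitaryGroup (Fin N) ℂ) :
    (Measure.pi fun _ : Fin N => complexGaussian).map (fun v => v ᵥ* U.1)
      = Measure.pi fun _ : Fin N => complexGaussian := by
  let T : (Fin N → ℂ) →L[ℝ] (Fin N → ℂ) :=
    LinearMap.toContinuousLinearMap ((Matrix.vecMulLinear U.1).restrictScalars ℝ)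
  have hT : (fun v => v ᵥ* U.1) = T := rfl
  have : IsProbabilityMeasure ((Measure.pi fun _ : Fin N => complexGaussian).map T) :=
    Measure.isProbabilityMeasure_map T.continuous.aemeasurable
  rw [hT]
  refine Measure.ext_of_charFunDual (funext fun L => ?_)
  rw [charFunDual_map, charFunDual_pi_complexGaussian, charFunDual_pi_complexGaussian]
  set c : Fin N → ℂ := fun i => (L (Pi.single i 1) : ℂ) - L (Pi.single i Complex.I) * Complex.I
  have h1 : ∀ i, (L.comp T) (Pi.single i 1) ^ 2 + (L.comp T) (Pi.single i Complex.I) ^ 2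
      = Complex.normSq ((U.1 *ᵥ c) i) := fun i => by
    have h2 : ∀ z : ℂ, (L.comp T) (Pi.single i z) = (z * (U.1 *ᵥ c) i).re := fun z => by
      change L (Pi.single i z ᵥ* U.1) = _
      rw [apply_eq_re_dotProduct, ← Matrix.dotProduct_mulVec, single_dotProduct]
    rw [h2, h2, Complex.normSq_apply]
    simp
    ring
  have h3 : ∀ i, L (Pi.single i 1) ^ 2 + L (Pi.single i Complex.I) ^ 2
      = Complex.normSq (c i) := fun i => by
    rw [Complex.normSq_apply]
    simp [c]
    ring
  simp only [h1, h3, sum_normSq_mulVec_unitary]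

/-- The law of a `K × N` matrix with independent standard complex Gaussian entries. -/
def gaussianMatrixLaw (K N : ℕ) : Measure (Matrix (Fin K) (Fin N) ℂ) :=
  (Measure.pi fun _ : Fin K => Measure.pi fun _ : Fin N => complexGaussian :
    Measure (Fin K → Fin N → ℂ))

instance (K N : ℕ) : IsProbabilityMeasure (gaussianMatrixLaw K N) :=
  inferInstanceAs (IsProbabilityMeasure (Measure.pi fun _ : Fin K =>
    Measure.pi fun _ : Fin N => complexGaussian))

theorem map_mul_gaussianMatrixLaw (K : ℕ) {N : ℕ} (U : Matrix.unitaryGroup (Fin N) ℂ) :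
    (gaussianMatrixLaw K N).map (fun M => M * U.1) = gaussianMatrixLaw K N := by
  have hm : Measurable fun v : Fin N → ℂ => v ᵥ* U.1 :=
    (Continuous.matrix_vecMul continuous_id continuous_const).measurable
  have : ∀ _ : Fin K, SigmaFinite
      ((Measure.pi fun _ : Fin N => complexGaussian).map fun v => v ᵥ* U.1) := fun _ => by
    rw [map_vecMul_pi_complexGaussian]; infer_instance
  have h := Measure.pi_map_pi (μ := fun _ : Fin K => Measure.pi fun _ : Fin N => complexGaussian)
    (f := fun _ v => v ᵥ* U.1) fun _ => hm.aemeasurable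
  simp only [map_vecMul_pi_complexGaussian] at h
  exact h

/-- The noise comes as independent columns, while unitary invariance acts on rows; this passes from
one grouping to the other. -/
theorem map_transpose_pi (K N : ℕ) :
    (Measure.pi fun _ : Fin N => Measure.pi fun _ : Fin K => complexGaussian).map
      (fun c => Matrix.of fun i j => c j i) = gaussianMatrixLaw K N := by
  let T : (Fin N → Fin K → ℂ) →L[ℝ] (Fin K → Fin N → ℂ) :=
    ContinuousLinearMap.pi fun i => ContinuousLinearMap.pi fun j =>
      (ContinuousLinearMap.proj (R := ℝ) (φ := fun _ : Fin K => ℂ) i).comp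
        (ContinuousLinearMap.proj (R := ℝ) (φ := fun _ : Fin N => Fin K → ℂ) j)
  have : IsProbabilityMeasure
      ((Measure.pi fun _ : Fin N => Measure.pi fun _ : Fin K => complexGaussian).map T) :=
    Measure.isProbabilityMeasure_map T.continuous.aemeasurable
  change Measure.map T _ = Measure.pi fun _ : Fin K => Measure.pi fun _ : Fin N => complexGaussian
  refine Measure.ext_of_charFunDual (funext fun L => ?_)
  rw [charFunDual_map]
  simp only [charFunDual_pi]
  rw [Finset.prod_comm]
  refine Finset.prod_congr rfl fun i _ => Finset.prod_congr rfl fun j _ => ?_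
  refine congrArg _ (ContinuousLinearMap.ext fun z => congrArg L
    (funext fun a => funext fun b => ?_))
  by_cases ha : a = i <;> by_cases hb : b = j <;> simp [T, ha, hb]

/-! ### Finite selections of coordinates -/

/-- Distinct `j` read distinct coordinates of the pair of sequences, so the preimage of a box is a
product of two cylinders. The reversal matches the numbering of negative eigenvalues from the
bottom. -/
theorem map_ite_infinitePi_prod {X : Type*} [MeasurableSpace X] (ν : Measure X)
    [IsProbabilityMeasure ν] {N : ℕ} (p : Fin N → Prop) [DecidablePred p] :
    ((Measure.infinitePi fun _ : ℕ => ν).prod (Measure.infinitePi fun _ : ℕ => ν)).map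
      (fun q (j : Fin N) => if p j then q.1 j else q.2 j.rev) = Measure.pi fun _ => ν := by
  refine (Measure.pi_eq fun s hs => ?_).symm
  have hm : Measurable fun (q : (ℕ → X) × (ℕ → X)) (j : Fin N) =>
      if p j then q.1 j else q.2 j.rev := by
    refine measurable_pi_iff.2 fun j => ?_
    by_cases h : p j
    · simp only [h, if_true]; fun_prop
    · simp only [h, if_false]; fun_prop
  -- Sides of the box for the first sequence, and then, numbered backwards, for the second;
  -- coordinates beyond `N` are unconstrained.
  let t : ℕ → Set X := fun n => if h : n < N then s ⟨n, h⟩ else Set.univ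
  let t' : ℕ → Set X := fun n => if h : n < N then s (Fin.rev ⟨n, h⟩) else Set.univ
  have ht : ∀ j : Fin N, t j = s j := fun j => by simp [t]
  let e' : Fin N ↪ ℕ := ⟨fun j => j.rev, fun i j h => Fin.rev_injective (Fin.ext h)⟩
  have he' : ∀ j : Fin N, t' (e' j) = s j := fun j => by
    change t' j.rev = s j
    have := j.rev.2
    simp only [t', this, dif_pos, Fin.eta, Fin.rev_rev]
  have hpre : (fun (q : (ℕ → X) × (ℕ → X)) (j : Fin N) => if p j then q.1 j else q.2 j.rev) ⁻¹'
      Set.univ.pi s = ((((Finset.univ.filter p).map Fin.valEmbedding : Finset ℕ) : Set ℕ).pi t) ×ˢ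
        ((((Finset.univ.filter fun j => ¬ p j).map e' : Finset ℕ) : Set ℕ).pi t') := by
    ext q
    simp only [Set.mem_preimage, Set.mem_pi, Set.mem_univ, true_imp_iff, Set.mem_prod,
      Finset.coe_map, Set.forall_mem_image, Finset.coe_filter, Finset.mem_univ, true_and,
      Set.mem_ofPred_eq, Fin.valEmbedding_apply, ht, he']
    refine ⟨fun h => ⟨fun j hj => ?_, fun j hj => ?_⟩, fun h j => ?_⟩
    · have := h j
      rwa [if_pos hj] at this
    · have := h j
      rwa [if_neg hj] at this
    · by_cases hj : p j
      · rw [if_pos hj]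
        exact h.1 hj
      · rw [if_neg hj]
        exact h.2 hj
  have hmt : ∀ n, MeasurableSet (t n) := fun n => by
    by_cases h : n < N
    · simpa only [t, h, dif_pos] using hs _
    · simp [t, h]
  have hmt' : ∀ n, MeasurableSet (t' n) := fun n => by
    by_cases h : n < N
    · simpa only [t', h, dif_pos] using hs _
    · simp [t', h]
  rw [Measure.map_apply hm (MeasurableSet.univ_pi hs), hpre, Measure.prod_prod,
    Measure.infinitePi_pi _ fun n _ => hmt n, Measure.infinitePi_pi _ fun n _ => hmt' n,
    Finset.prod_map, Finset.prod_map, ← Finset.prod_filter_mul_prod_filter_not Finset.univ p]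
  simp [ht, he']

theorem map_restrict_infinitePi {X : Type*} [MeasurableSpace X] (ν : Measure X)
    [IsProbabilityMeasure ν] (N : ℕ) :
    (Measure.infinitePi fun _ : ℕ => ν).map (fun v (j : Fin N) => v j)
      = Measure.pi fun _ => ν := by
  have h := map_ite_infinitePi_prod ν (N := N) fun _ => True
  simp only [if_true] at h
  conv_lhs => rw [← Measure.fst_prod (μ := Measure.infinitePi fun _ : ℕ => ν)
    (ν := Measure.infinitePi fun _ : ℕ => ν)]
  rw [Measure.fst, Measure.map_map (by fun_prop) measurable_fst]
  exact h

theorem map_pi_restrict (K N : ℕ) :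
    (Measure.pi fun _ : Fin N => Measure.infinitePi fun _ : ℕ => complexGaussian).map
      (fun c => Matrix.of fun (i : Fin K) j => c j i) = gaussianMatrixLaw K N := by
  rw [← map_transpose_pi]
  have h := Measure.pi_map_pi (μ := fun _ : Fin N => Measure.infinitePi fun _ : ℕ =>
    complexGaussian) (f := fun _ v (i : Fin K) => v i) fun _ =>
      (by fun_prop : Measurable fun (v : ℕ → ℂ) (i : Fin K) => v i).aemeasurable
  simp only [map_restrict_infinitePi] at h
  rw [← h, Measure.map_map]
  · rfl
  · exact measurable_pi_iff.2 fun i => measurable_pi_iff.2 fun j => by fun_prop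
  · fun_prop

/-! ### The law of large numbers for `M M†` -/

theorem memLp_complexGaussian : MemLp (fun z : ℂ => z) 2 complexGaussian := by
  have hm : Measurable fun p : ℝ × ℝ => (p.1 : ℂ) + p.2 * Complex.I := by fun_prop
  refine (memLp_map_measure_iff (by fun_prop) hm.aemeasurable).2 ?_
  have h1 : MemLp (fun x : ℝ => x) 2 (gaussianReal 0 (1 / 2)) := memLp_id_gaussianReal 2
  have hf := (h1.comp_measurePreserving (measurePreserving_fst (μ := gaussianReal 0 (1 / 2))
    (ν := gaussianReal 0 (1 / 2)))).ofReal (K := ℂ)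
  have hs := (h1.comp_measurePreserving (measurePreserving_snd (μ := gaussianReal 0 (1 / 2))
    (ν := gaussianReal 0 (1 / 2)))).ofReal (K := ℂ)
  exact hf.add (hs.mul_const Complex.I)

theorem integral_complexGaussian : ∫ z, z ∂complexGaussian = 0 := by
  have hm : Measurable fun p : ℝ × ℝ => (p.1 : ℂ) + p.2 * Complex.I := by fun_prop
  have hi : Integrable (fun z : ℂ => z) complexGaussian :=
    memLp_complexGaussian.integrable one_le_two
  have h1 : Integrable (fun x : ℝ => x) (gaussianReal 0 (1 / 2)) :=
    (memLp_id_gaussianReal 1).integrable le_rfl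
  unfold complexGaussian
  rw [integral_map hm.aemeasurable (by fun_prop), integral_add, integral_mul_const]
  · rw [integral_fun_fst (fun x : ℝ => (x : ℂ)), integral_fun_snd (fun x : ℝ => (x : ℂ)),
      integral_complex_ofReal]
    simp
  · exact (h1.comp_fst _).ofReal
  · exact (h1.comp_snd _).ofReal.mul_const _

theorem integral_mul_star_complexGaussian : ∫ z, z * star z ∂complexGaussian = 1 := by
  have hm : Measurable fun p : ℝ × ℝ => (p.1 : ℂ) + p.2 * Complex.I := by fun_prop
  have h2 : Integrable (fun x : ℝ => x ^ 2) (gaussianReal 0 (1 / 2)) :=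
    (memLp_id_gaussianReal 2).integrable_sq
  have hv : ∫ x, x ^ 2 ∂gaussianReal 0 (1 / 2) = 1 / 2 := by
    have := variance_fun_id_gaussianReal (μ := 0) (v := 1 / 2)
    rw [variance_of_integral_eq_zero (by fun_prop) (by simp)] at this
    simpa using this
  unfold complexGaussian
  rw [integral_map hm.aemeasurable (by fun_prop)]
  have h : ∀ p : ℝ × ℝ, ((p.1 : ℂ) + p.2 * Complex.I) * star ((p.1 : ℂ) + p.2 * Complex.I)
      = ((p.1 ^ 2 + p.2 ^ 2 : ℝ) : ℂ) := fun p => by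
    rw [← Complex.normSq_add_mul_I, ← Complex.mul_conj]
    rfl
  simp only [h]
  rw [integral_complex_ofReal, integral_add (h2.comp_fst _) (h2.comp_snd _),
    integral_fun_fst (fun x : ℝ => x ^ 2), integral_fun_snd (fun x : ℝ => x ^ 2), hv]
  simp
  norm_num

/-- The law of a sequence of independent infinite standard complex Gaussian vectors. -/
def gaussianSequenceLaw : Measure (ℕ → ℕ → ℂ) :=
  Measure.infinitePi fun _ : ℕ => Measure.infinitePi fun _ : ℕ => complexGaussian

instance : IsProbabilityMeasure gaussianSequenceLaw := by
  unfold gaussianSequenceLaw; infer_instance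

/-- Strong law for the i.i.d. products over `j`. Their mean is `E|z|² = 1` if `a = b`, and otherwise
vanishes by independence and centring. -/
theorem ae_tendsto_average (a b : ℕ) :
    ∀ᵐ ω ∂gaussianSequenceLaw, Tendsto
      (fun n : ℕ => (n : ℝ)⁻¹ • ∑ j ∈ Finset.range n, ω j a * star (ω j b)) atTop
      (𝓝 (if a = b then 1 else 0)) := by
  have hmp : ∀ j, MeasurePreserving (Function.eval j) gaussianSequenceLaw
      (Measure.infinitePi fun _ : ℕ => complexGaussian) := fun j =>
    measurePreserving_eval_infinitePi (fun _ : ℕ => Measure.infinitePi fun _ : ℕ =>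
      complexGaussian) j
  have hmp' : ∀ i, MeasurePreserving (Function.eval i)
      (Measure.infinitePi fun _ : ℕ => complexGaussian) complexGaussian := fun i =>
    measurePreserving_eval_infinitePi (fun _ : ℕ => complexGaussian) i
  have hφ : Measurable fun v : ℕ → ℂ => v a * star (v b) :=
    (measurable_pi_apply a).mul (continuous_star.measurable.comp (measurable_pi_apply b))
  have hLp : ∀ i, MemLp (fun v : ℕ → ℂ => v i) 2
      (Measure.infinitePi fun _ : ℕ => complexGaussian) := fun i =>
    memLp_complexGaussian.comp_measurePreserving (hmp' i)
  have hint : Integrable (fun v : ℕ → ℂ => v a * star (v b))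
      (Measure.infinitePi fun _ : ℕ => complexGaussian) :=
    (hLp a).integrable_mul (hLp b).star
  have hval : ∫ v, v a * star (v b) ∂(Measure.infinitePi fun _ : ℕ => complexGaussian)
      = if a = b then 1 else 0 := by
    split_ifs with hab
    · subst hab
      have hi := integral_map (μ := Measure.infinitePi fun _ : ℕ => complexGaussian)
        (f := fun z : ℂ => z * star z)
        (hmp' a).measurable.aemeasurable (by fun_prop)
      rw [(hmp' a).map_eq, integral_mul_star_complexGaussian] at hi
      exact hi.symm
    · have hind : iIndepFun (fun i (v : ℕ → ℂ) => v i)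
          (Measure.infinitePi fun _ : ℕ => complexGaussian) :=
        iIndepFun_infinitePi (X := fun _ z => z) fun _ => measurable_id
      have hind2 : IndepFun (fun v : ℕ → ℂ => v a) (fun v : ℕ → ℂ => star (v b))
          (Measure.infinitePi fun _ : ℕ => complexGaussian) :=
        (hind.indepFun hab).comp measurable_id continuous_star.measurable
      rw [hind2.integral_fun_mul_eq_mul_integral
        (measurable_pi_apply a).aestronglyMeasurable
        (continuous_star.measurable.comp (measurable_pi_apply b)).aestronglyMeasurable]
      have h0 : ∫ v : ℕ → ℂ, v a ∂(Measure.infinitePi fun _ : ℕ => complexGaussian) = 0 := by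
        have hi := integral_map (μ := Measure.infinitePi fun _ : ℕ => complexGaussian)
          (f := fun z : ℂ => z)
          (hmp' a).measurable.aemeasurable (by fun_prop)
        rw [(hmp' a).map_eq, integral_complexGaussian] at hi
        exact hi.symm
      rw [h0, zero_mul]
  have hindep : iIndepFun (fun j (ω : ℕ → ℕ → ℂ) => ω j a * star (ω j b)) gaussianSequenceLaw :=
    iIndepFun_infinitePi (P := fun _ : ℕ => Measure.infinitePi fun _ : ℕ => complexGaussian)
      (X := fun _ v => v a * star (v b)) fun _ => hφ
  have hE : ∫ ω, ω 0 a * star (ω 0 b) ∂gaussianSequenceLaw = if a = b then 1 else 0 := by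
    rw [← hval, ← (hmp 0).map_eq,
      integral_map (hmp 0).measurable.aemeasurable hφ.aestronglyMeasurable]
  have h := strong_law_ae (μ := gaussianSequenceLaw)
    (fun j (ω : ℕ → ℕ → ℂ) => ω j a * star (ω j b))
    ((hmp 0).integrable_comp_of_integrable hint) (fun i j hij => hindep.indepFun hij)
    fun i => (IdentDistrib.mk (hmp i).measurable.aemeasurable (hmp 0).measurable.aemeasurable
      ((hmp i).map_eq.trans (hmp 0).map_eq.symm)).comp hφ
  rw [hE] at h
  exact h

section Norm

open scoped Matrix.Norms.L2Operator

theorem tendsto_gaussianMatrixLaw_bad (K : ℕ) {η : ℝ} (hη : 0 < η) :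
    Tendsto (fun N : ℕ => gaussianMatrixLaw K N
      {M | η ≤ ‖(N : ℝ)⁻¹ • (M * Mᴴ) - 1‖}) atTop (𝓝 0) := by
  -- Coupling: the Gaussian matrices of all sizes are truncations of one infinite array, so almost
  -- sure convergence makes sense and yields convergence in probability.
  let T : ∀ N, (ℕ → ℕ → ℂ) → Matrix (Fin K) (Fin N) ℂ := fun N ω => Matrix.of fun i j => ω j i
  have hTm : ∀ N, Measurable (T N) := fun N =>
    measurable_pi_iff.2 fun i => measurable_pi_iff.2 fun j => by
      change Measurable fun ω : ℕ → ℕ → ℂ => ω j i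
      fun_prop
  have hT : ∀ N, gaussianSequenceLaw.map (T N) = gaussianMatrixLaw K N := fun N => by
    rw [← map_pi_restrict, ← map_restrict_infinitePi, Measure.map_map]
    · rfl
    · exact measurable_pi_iff.2 fun i => measurable_pi_iff.2 fun j => by
        change Measurable fun ω : Fin N → ℕ → ℂ => ω j i
        fun_prop
    · fun_prop
  have hcont : ∀ N : ℕ, Continuous fun M : Matrix (Fin K) (Fin N) ℂ =>
      (N : ℝ)⁻¹ • (M * Mᴴ) - 1 := fun N =>
    (Continuous.const_smul (Continuous.matrix_mul continuous_id
      (Continuous.matrix_conjTranspose continuous_id)) (N : ℝ)⁻¹).sub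
      continuous_const
  have hae : ∀ᵐ ω ∂gaussianSequenceLaw,
      Tendsto (fun N : ℕ => (N : ℝ)⁻¹ • (T N ω * (T N ω)ᴴ) - 1) atTop (𝓝 0) := by
    have h : ∀ᵐ ω ∂gaussianSequenceLaw, ∀ a b : Fin K, Tendsto
        (fun n : ℕ => (n : ℝ)⁻¹ • ∑ j ∈ Finset.range n, ω j a * star (ω j b)) atTop
        (𝓝 (if (a : ℕ) = b then 1 else 0)) :=
      ae_all_iff.2 fun a => ae_all_iff.2 fun b => ae_tendsto_average a b
    filter_upwards [h] with ω hω
    rw [← sub_self (1 : Matrix (Fin K) (Fin K) ℂ)]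
    refine Tendsto.sub ?_ tendsto_const_nhds
    -- The operator norm induces the entrywise topology, and there are only `K²` entries.
    refine tendsto_pi_nhds.2 fun a => tendsto_pi_nhds.2 fun b => ?_
    have := hω a b
    convert! this using 2 with n
    · simp [T, Matrix.mul_apply, Finset.sum_range]
    · simp [Matrix.one_apply, Fin.ext_iff]
  have hmeas := tendstoInMeasure_of_tendsto_ae (μ := gaussianSequenceLaw)
    (fun N => ((hcont N).measurable.comp (hTm N)).aestronglyMeasurable) hae
  have := tendstoInMeasure_iff_norm.1 hmeas η hη
  refine this.congr fun N => ?_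
  rw [← hT N, Measure.map_apply (hTm N)]
  · simp only [sub_zero]
    rfl
  · exact measurableSet_le measurable_const (hcont N).norm.measurable

end Norm

/-! ### The boundary kernels at embedded points -/

theorem map_noiseLaw :
    noiseLaw.map (fun s => (s.ξ, s.ζ)) = gaussianSequenceLaw.prod gaussianSequenceLaw := by
  have hm : Measurable fun s : Noise => (s.ξ, s.ζ) := measurable_noise.snd
  have hm' : Measurable fun p : (ℕ → ℕ → ℝ) × (ℕ → ℕ → ℂ) × (ℕ → ℕ → ℂ) =>
      (⟨p.1, p.2.1, p.2.2⟩ : Noise) := measurable_comap_iff.2 measurable_id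
  rw [noiseLaw, Measure.map_map hm hm']
  have h := Measure.snd_prod
    (μ := Measure.infinitePi fun _ : ℕ => Measure.infinitePi fun _ : ℕ => gaussianReal 0 1)
    (ν := gaussianSequenceLaw.prod gaussianSequenceLaw)
  exact h

/-- The matrix with columns `ξ j` for `j` in `p`, and `ζ (N - 1 - j)` otherwise. -/
def noiseColumns (K : ℕ) {N : ℕ} (p : Fin N → Prop) [DecidablePred p] (s : Noise) :
    Matrix (Fin K) (Fin N) ℂ :=
  Matrix.of fun i j => if p j then s.ξ j i else s.ζ j.rev i

theorem measurable_noiseColumns (K : ℕ) {N : ℕ} (p : Fin N → Prop) [DecidablePred p] :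
    Measurable (noiseColumns K p) := by
  refine measurable_pi_iff.2 fun i => measurable_pi_iff.2 fun j => ?_
  change Measurable fun s : Noise => if p j then s.ξ j i else s.ζ j.rev i
  by_cases h : p j
  · simpa only [h, if_true] using measurable_ξ _ _
  · simpa only [h, if_false] using measurable_ζ _ _

theorem map_noiseColumns (K : ℕ) {N : ℕ} (p : Fin N → Prop) [DecidablePred p] :
    noiseLaw.map (noiseColumns K p) = gaussianMatrixLaw K N := by
  have h1 : Measurable fun (q : (ℕ → ℕ → ℂ) × (ℕ → ℕ → ℂ)) (j : Fin N) =>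
      if p j then q.1 j else q.2 j.rev := by
    refine measurable_pi_iff.2 fun j => ?_
    by_cases h : p j
    · simp only [h, if_true]; fun_prop
    · simp only [h, if_false]; fun_prop
  have h2 : Measurable fun c : Fin N → ℕ → ℂ => Matrix.of fun (i : Fin K) j => c j i :=
    measurable_pi_iff.2 fun i => measurable_pi_iff.2 fun j => by
      change Measurable fun ω : Fin N → ℕ → ℂ => ω j i
      fun_prop
  rw [← map_pi_restrict, ← map_ite_infinitePi_prod _ p]
  change _ = ((gaussianSequenceLaw.prod gaussianSequenceLaw).map _).map _
  rw [← map_noiseLaw, Measure.map_map h1 measurable_noise.snd,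
    Measure.map_map h2 (h1.comp measurable_noise.snd)]
  congr 1
  ext s i j
  by_cases h : p j <;> simp [noiseColumns, h]

theorem seriesLim_eq_sum {u : ℕ → ℂ} (N : ℕ) (hu : ∀ j, N ≤ j → u j = 0) :
    seriesLim u = ∑ j : Fin N, u j := by
  have h : Tendsto (fun n => ∑ j ∈ Finset.range n, u j) atTop
      (𝓝 (∑ j ∈ Finset.range N, u j)) := by
    refine tendsto_const_nhds.congr' ?_
    filter_upwards [eventually_ge_atTop N] with n hn
    refine Finset.sum_subset (Finset.range_mono hn) fun j _ hj => hu j ?_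
    simpa using hj
  rw [seriesLim, if_pos ⟨_, h⟩, h.limUnder_eq, Finset.sum_range]

/-- Because `max(t,0)² + max(-t,0)² = t²`, embedded points carry no Gaussian component. -/
theorem embed_δ {N : ℕ} (x : WeylChamber N) :
    (embed x).δ - ∑' i, ((embed x).xp.1 i ^ 2 + (embed x).xm.1 i ^ 2) = 0 := by
  rw [(embed x).summable_xp.tsum_add (embed x).summable_xm]
  simp only [embed]
  rw [(hasSum_scaledPosPart _ 2 two_ne_zero).tsum_eq,
    (hasSum_scaledPosPart _ 2 two_ne_zero).tsum_eq]
  have h : ∑ i, ((N : ℝ)⁻¹ * max (negRev x.1 i) 0) ^ 2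
      = ∑ i, ((N : ℝ)⁻¹ * max (-x.1 i) 0) ^ 2 :=
    Fintype.sum_equiv Fin.revPerm _ _ fun i => rfl
  rw [h, ← Finset.sum_add_distrib, Finset.mul_sum, ← Finset.sum_sub_distrib]
  refine Finset.sum_eq_zero fun i _ => ?_
  rcases le_total (x.1 i) 0 with hi | hi
  · rw [max_eq_right hi, max_eq_left (neg_nonneg.2 hi)]; ring
  · rw [max_eq_left hi, max_eq_right (neg_nonpos.2 hi)]; ring

theorem congrH_diagH_apply {K N : ℕ} (M : Matrix (Fin K) (Fin N) ℂ) (d : Fin N → ℝ)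
    (i k : Fin K) : (congrH M (diagH d)).1 i k = ∑ j, (d j : ℂ) * (M i j * star (M k j)) := by
  change (M * Matrix.diagonal (fun i => (d i : ℂ)) * Mᴴ) i k = _
  rw [Matrix.mul_apply]
  refine Finset.sum_congr rfl fun j _ => ?_
  rw [Matrix.mul_diagonal, Matrix.conjTranspose_apply]
  ring

/-- Writing `γ` as the sum of the `xⱼ/N` makes the identity hold for each `j`: only one of the two
series contributes, and its compensator cancels the share `xⱼ/N` of `γ`. -/
theorem infCorner_infiniteMatrix_embed (K : ℕ) {N : ℕ} (x : WeylChamber N) (s : Noise) :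
    infCorner K (infiniteMatrix (embed x) s) (isHermitian_infiniteMatrix _ s)
      = congrH (noiseColumns K (fun j => 0 ≤ x.1 j) s) (diagH ((N : ℝ)⁻¹ • x.1)) := by
  refine Subtype.ext (Matrix.ext fun i k => ?_)
  rw [congrH_diagH_apply]
  simp only [infCorner, Matrix.submatrix_apply, infiniteMatrix, embed_δ, Real.sqrt_zero,
    Complex.ofReal_zero, zero_smul, add_zero, Matrix.sub_apply, Matrix.add_apply,
    Matrix.smul_apply, smul_eq_mul, matrixSeries, Matrix.of_apply, outer, Matrix.vecMulVec_apply,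
    Pi.star_apply]
  rw [seriesLim_eq_sum N fun j hj => by simp [embed, scaledPosPart, not_lt.2 hj],
    seriesLim_eq_sum N fun j hj => by simp [embed, scaledPosPart, not_lt.2 hj]]
  -- The negative parts are listed from the smallest coordinate upwards; reversal aligns them with
  -- `x`.
  have hrev : ∑ j : Fin N, (((embed x).xm.1 j : ℝ) : ℂ)
        * (s.ζ j i * star (s.ζ j k) - (1 : Matrix ℕ ℕ ℂ) i k)
      = ∑ j : Fin N, (((N : ℝ)⁻¹ * max (-x.1 j) 0 : ℝ) : ℂ)
        * (s.ζ j.rev i * star (s.ζ j.rev k) - (1 : Matrix ℕ ℕ ℂ) i k) :=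
    Fintype.sum_equiv Fin.revPerm _ _ fun j => by
      simp [embed, scaledPosPart, negRev]
  rw [hrev]
  have hγ : (((embed x).γ : ℝ) : ℂ) = ∑ j, (((N : ℝ)⁻¹ * x.1 j : ℝ) : ℂ) := by
    simp [embed, Finset.mul_sum]
  rw [hγ, Finset.sum_mul, ← Finset.sum_add_distrib, ← Finset.sum_sub_distrib]
  refine Finset.sum_congr rfl fun j _ => ?_
  have hxp : (embed x).xp.1 j = (N : ℝ)⁻¹ * max (x.1 j) 0 := by simp [embed, scaledPosPart]
  rw [hxp]
  by_cases h : 0 ≤ x.1 j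
  · rw [max_eq_left h, max_eq_right (neg_nonpos.2 h)]
    simp [noiseColumns, h]
    ring
  · rw [max_eq_right (not_le.1 h).le, max_eq_left (neg_nonneg.2 (not_le.1 h).le)]
    simp [noiseColumns, h]
    ring

theorem infCorner_infiniteMatrixPos_embedPos (K : ℕ) {N : ℕ} (x : PosWeylChamber N) (s : Noise) :
    infCorner K (infiniteMatrixPos (embedPos x) s) (isHermitian_infiniteMatrixPos _ s)
      = congrH (noiseColumns K (fun j => 0 ≤ x.1.1 j) s) (diagH ((N : ℝ)⁻¹ • x.1.1)) := by
  refine Subtype.ext (Matrix.ext fun i k => ?_)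
  have hγ : (embedPos x).γ - ∑' j, (embedPos x).x.1 j = 0 := by
    have h := (hasSum_scaledPosPart x.1.1 1 one_ne_zero).tsum_eq
    simp only [pow_one] at h
    simp only [embedPos, scaled_eq, h, Finset.mul_sum, ← Finset.sum_sub_distrib]
    exact Finset.sum_eq_zero fun i _ => by rw [max_eq_left (x.2 i), sub_self]
  rw [congrH_diagH_apply]
  simp only [infCorner, Matrix.submatrix_apply, infiniteMatrixPos, hγ,
    Complex.ofReal_zero, zero_smul, zero_add, Matrix.smul_apply, smul_eq_mul, matrixSeries,
    Matrix.of_apply, outer, Matrix.vecMulVec_apply, Pi.star_apply]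
  rw [seriesLim_eq_sum N fun j hj => by simp [embedPos, scaled, not_lt.2 hj]]
  refine Finset.sum_congr rfl fun j _ => ?_
  simp [embedPos, scaled, noiseColumns, x.2 j]

/-- The columns used depend on the signs of `x`, but their joint law does not, so `x` survives only
in the diagonal matrix. -/
theorem boundaryKernel_embed (K : ℕ) {N : ℕ} (x : WeylChamber N) :
    boundaryKernel K (embed x) = (gaussianMatrixLaw K N).map fun M =>
      eval K (congrH M (diagH ((N : ℝ)⁻¹ • x.1))) := by
  rw [← map_noiseColumns K fun j => 0 ≤ x.1 j, Measure.map_map _ (measurable_noiseColumns K _)]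
  · simp only [boundaryKernel, infCorner_infiniteMatrix_embed]
    rfl
  · exact (continuous_eval_congrH continuous_id _).measurable

theorem boundaryKernelPos_embedPos (K : ℕ) {N : ℕ} (x : PosWeylChamber N) :
    boundaryKernelPos K (embedPos x) = boundaryKernel K (embed x.1) := by
  simp only [boundaryKernel, boundaryKernelPos, infCorner_infiniteMatrix_embed,
    infCorner_infiniteMatrixPos_embedPos]

/-! ### Comparison of the kernels -/

section Comparison

open scoped Matrix.Norms.L2Operator

theorem congrH_diagH_smul {K N : ℕ} (c : ℝ) (M : Matrix (Fin K) (Fin N) ℂ) (d : Fin N → ℝ) :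
    congrH M (diagH (c ^ 2 • d)) = congrH (c • M) (diagH d) := by
  refine Subtype.ext (Matrix.ext fun i k => ?_)
  rw [congrH_diagH_apply, congrH_diagH_apply]
  refine Finset.sum_congr rfl fun j _ => ?_
  simp
  ring

theorem integrable_comp_of_bound {X Y : Type*} [MeasurableSpace X] [MeasurableSpace Y]
    {μ : Measure X} [IsFiniteMeasure μ] {f : Y → ℝ} (hf : Measurable f) {C : ℝ}
    (hC : ∀ y, |f y| ≤ C) {φ : X → Y} (hφ : Measurable φ) : Integrable (fun x => f (φ x)) μ :=
  Integrable.of_bound (hf.comp hφ).aestronglyMeasurable C (ae_of_all _ fun x => hC (φ x))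

/-- The integral over `M U` is the same for every fixed unitary `U`; averaging over Haar measure and
applying Fubini inserts an independent `U`. -/
theorem integral_boundaryKernel_embed {K N : ℕ} {f : WeylChamber K → ℝ} (hf : Continuous f)
    {C : ℝ} (hC : ∀ y, |f y| ≤ C) (x : WeylChamber N) :
    ∫ y, f y ∂boundaryKernel K (embed x)
      = ∫ M, (∫ U : Matrix.unitaryGroup (Fin N) ℂ,
          f (eval K (congrH (M * U.1) (diagH ((N : ℝ)⁻¹ • x.1)))) ∂haarUnitary N)
        ∂gaussianMatrixLaw K N := by
  set D := diagH ((N : ℝ)⁻¹ • x.1)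
  have hc : Continuous fun M : Matrix (Fin K) (Fin N) ℂ => f (eval K (congrH M D)) :=
    hf.comp (continuous_eval_congrH continuous_id D)
  have hJ : Continuous fun p : Matrix (Fin K) (Fin N) ℂ × Matrix.unitaryGroup (Fin N) ℂ =>
      eval K (congrH (p.1 * p.2.1) D) :=
    continuous_eval_congrH
      (continuous_fst.matrix_mul (continuous_subtype_val.comp continuous_snd)) D
  have hU : ∀ U : Matrix.unitaryGroup (Fin N) ℂ,
      ∫ M, f (eval K (congrH (M * U.1) D)) ∂gaussianMatrixLaw K N
        = ∫ y, f y ∂boundaryKernel K (embed x) := fun U => by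
    have hm : Continuous fun M : Matrix (Fin K) (Fin N) ℂ => M * U.1 :=
      continuous_id.matrix_mul continuous_const
    have hD : Continuous fun M : Matrix (Fin K) (Fin N) ℂ => eval K (congrH M D) :=
      continuous_eval_congrH continuous_id D
    rw [boundaryKernel_embed, integral_map hD.measurable.aemeasurable
      hf.measurable.aestronglyMeasurable]
    conv_rhs => rw [← map_mul_gaussianMatrixLaw K U]
    rw [integral_map hm.measurable.aemeasurable hc.measurable.aestronglyMeasurable]
  rw [integral_integral_swap]
  · simp [hU]
  · exact integrable_comp_of_bound hf.measurable hC hJ.measurable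

/-- Conditioning on `M`: off the bad event the polar factor `S` moves the integrand by at most `ε`,
on it the trivial bound `2C` applies. The right side does not involve `x`. -/
theorem abs_integral_boundaryKernel_sub_le {K N : ℕ} (hKN : K ≤ N) (hN : 0 < N)
    {f : WeylChamber K → ℝ} (hf : Continuous f) {C : ℝ} (hC : ∀ y, |f y| ≤ C) {ε η : ℝ}
    (hη0 : 0 ≤ η) (hη : η < 1)
    (hS : ∀ S : Matrix (Fin K) (Fin K) ℂ, ‖S - 1‖ ≤ η →
      ∀ B : HermitianMatrix K, |f (eval K (congrH S B)) - f (eval K B)| ≤ ε)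
    (x : WeylChamber N) :
    |(∫ y, f y ∂boundaryKernel K (embed x)) - ∫ y, f y ∂cornerKernel K hKN x|
      ≤ ε + 2 * C * (gaussianMatrixLaw K N).real {M | η ≤ ‖(N : ℝ)⁻¹ • (M * Mᴴ) - 1‖} := by
  have hN' : (0 : ℝ) < N := Nat.cast_pos.2 hN
  set bad := {M : Matrix (Fin K) (Fin N) ℂ | η ≤ ‖(N : ℝ)⁻¹ • (M * Mᴴ) - 1‖}
  have hbad : MeasurableSet bad := by
    have hcont : Continuous fun M : Matrix (Fin K) (Fin N) ℂ => (N : ℝ)⁻¹ • (M * Mᴴ) - 1 :=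
      (Continuous.const_smul (Continuous.matrix_mul continuous_id
        (Continuous.matrix_conjTranspose continuous_id)) (N : ℝ)⁻¹).sub continuous_const
    exact measurableSet_le measurable_const hcont.norm.measurable
  have hint : ∀ (M : Matrix (Fin K) (Fin N) ℂ) (A : HermitianMatrix N),
      Integrable (fun U : Matrix.unitaryGroup (Fin N) ℂ => f (eval K (congrH (M * U.1) A)))
        (haarUnitary N) := fun M A =>
    integrable_comp_of_bound hf.measurable hC (continuous_eval_congrH_mul M A).measurable
  have hcorner : ∫ y, f y ∂cornerKernel K hKN x
      = ∫ U : Matrix.unitaryGroup (Fin N) ℂ,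
        f (eval K (congrH (topRows hKN * U.1) (diagH x.1))) ∂haarUnitary N := by
    rw [cornerKernel_apply, integral_map
      (continuous_eval_congrH_mul _ _).measurable.aemeasurable hf.measurable.aestronglyMeasurable]
  have hI : |∫ y, f y ∂cornerKernel K hKN x| ≤ C := by
    rw [hcorner]
    simpa using norm_integral_le_of_norm_le_const (μ := haarUnitary N)
      (f := fun U => f (eval K (congrH (topRows hKN * U.1) (diagH x.1))))
      (ae_of_all _ fun U => hC _)
  have hC0 : 0 ≤ C := (abs_nonneg _).trans hI
  set I := ∫ y, f y ∂cornerKernel K hKN x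
  set J : Matrix (Fin K) (Fin N) ℂ → ℝ := fun M => ∫ U : Matrix.unitaryGroup (Fin N) ℂ,
    f (eval K (congrH (M * U.1) (diagH ((N : ℝ)⁻¹ • x.1)))) ∂haarUnitary N with hJdef
  have hJ : ∀ M, |J M| ≤ C := fun M => by
    simpa using norm_integral_le_of_norm_le_const (μ := haarUnitary N)
      (f := fun U => f (eval K (congrH (M * U.1) (diagH ((N : ℝ)⁻¹ • x.1)))))
      (ae_of_all _ fun U => hC _)
  have hgood : ∀ M ∉ bad, |J M - I| ≤ ε := fun M hM => by
    have hM : ‖(N : ℝ)⁻¹ • (M * Mᴴ) - 1‖ < η := not_le.1 hM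
    -- The factor `N⁻¹` of the diagonal matrix is split as a square and moved into `M`.
    have hsq : (√(N : ℝ))⁻¹ ^ 2 = (N : ℝ)⁻¹ := by rw [inv_pow, Real.sq_sqrt hN'.le]
    obtain ⟨S, W, hS1, hZ⟩ := exists_polar hKN hη (Z := (√(N : ℝ))⁻¹ • M) (by
      rw [Matrix.conjTranspose_smul, star_trivial, Matrix.smul_mul, Matrix.mul_smul, smul_smul,
        ← sq, hsq]
      exact hM.le)
    have hJM : J M = ∫ U : Matrix.unitaryGroup (Fin N) ℂ,
        f (eval K (congrH S (congrH (topRows hKN * U.1) (diagH x.1)))) ∂haarUnitary N := by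
      -- `J M` is the left side; substituting `W U` for `U` in the target integral produces `S P W
      -- U`, which is `M U/√N`.
      rw [← integral_mul_left_eq_self _ W]
      simp only [hJdef]
      refine integral_congr_ae (ae_of_all _ fun U => ?_)
      simp only
      rw [← hsq, congrH_diagH_smul, ← Matrix.smul_mul, hZ, congrH_congrH, Submonoid.coe_mul]
      simp only [Matrix.mul_assoc]
    have hint' : Integrable (fun U : Matrix.unitaryGroup (Fin N) ℂ =>
        f (eval K (congrH S (congrH (topRows hKN * U.1) (diagH x.1))))) (haarUnitary N) := by
      simpa only [congrH_congrH, ← Matrix.mul_assoc] using hint (S * topRows hKN) (diagH x.1)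
    rw [hJM, hcorner, ← integral_sub hint' (hint _ _)]
    simpa using norm_integral_le_of_norm_le_const (μ := haarUnitary N)
      (f := fun U => f (eval K (congrH S (congrH (topRows hKN * U.1) (diagH x.1))))
        - f (eval K (congrH (topRows hKN * U.1) (diagH x.1))))
      (ae_of_all _ fun U => hS S hS1 _)
  -- Needed for the bound on the bad event; it follows by testing the hypothesis on `S = 1`, `B =
  -- 0`.
  have hε : 0 ≤ ε :=
    (abs_nonneg _).trans (hS 1 (by simpa using hη0) ⟨0, Matrix.isHermitian_zero⟩)
  have hJm : Integrable J (gaussianMatrixLaw K N) := by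
    have hcont : Continuous fun p : Matrix (Fin K) (Fin N) ℂ × Matrix.unitaryGroup (Fin N) ℂ =>
        eval K (congrH (p.1 * p.2.1) (diagH ((N : ℝ)⁻¹ • x.1))) :=
      continuous_eval_congrH
        (continuous_fst.matrix_mul (continuous_subtype_val.comp continuous_snd)) _
    exact (integrable_comp_of_bound (μ := (gaussianMatrixLaw K N).prod (haarUnitary N))
      hf.measurable hC hcont.measurable).integral_prod_left
  have hbound : ∀ M, |J M - I| ≤ ε + bad.indicator (fun _ => 2 * C) M := fun M => by
    by_cases hM : M ∈ bad
    · rw [Set.indicator_of_mem hM]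
      have := abs_sub (J M) I
      linarith [hJ M]
    · rw [Set.indicator_of_notMem hM, add_zero]
      exact hgood M hM
  have hind : Integrable (bad.indicator fun _ => 2 * C) (gaussianMatrixLaw K N) :=
    (integrable_const _).indicator hbad
  calc |(∫ y, f y ∂boundaryKernel K (embed x)) - I|
      = ‖∫ M, (J M - I) ∂gaussianMatrixLaw K N‖ := by
        rw [integral_boundaryKernel_embed hf hC, integral_sub hJm (integrable_const _)]
        simp [hJdef]
    _ ≤ ∫ M, (ε + bad.indicator (fun _ => 2 * C) M) ∂gaussianMatrixLaw K N :=
        norm_integral_le_of_norm_le ((integrable_const _).add hind) (ae_of_all _ hbound)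
    _ = _ := by
        rw [integral_add (integrable_const _) hind, integral_indicator hbad]
        simp [mul_comm]

/-- The tolerance `η` is fixed by `f` and `ε/2`, then `N` by the law of large numbers; `x` is chosen
last, hence the uniformity. -/
theorem eventually_abs_integral_sub_le {K : ℕ} {f : WeylChamber K → ℝ} (hf : Continuous f)
    {R : ℝ} (hR : ∀ y, f y ≠ 0 → ‖y.1‖ ≤ R) {ε : ℝ} (hε : 0 < ε) :
    ∀ᶠ N : ℕ in atTop, ∀ (h : K < N) (x : WeylChamber N),
      |(∫ y, f y ∂boundaryKernel K (embed x)) - ∫ y, f y ∂cornerKernel K h.le x| ≤ ε := by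
  obtain ⟨C, hC⟩ : ∃ C, ∀ y, |f y| ≤ C := by
    obtain ⟨C, hC⟩ := (isCompact_weylChamber_norm_le K R).exists_bound_of_continuousOn
      hf.continuousOn
    refine ⟨max C 0, fun y => ?_⟩
    by_cases hy : f y = 0
    · simp [hy]
    · exact (hC y (hR y hy)).trans (le_max_left _ _)
  obtain ⟨η, hη0, hη1, hS⟩ := abs_sub_congrH_le hf hR (half_pos hε)
  have ht : Tendsto (fun N : ℕ => 2 * C * (gaussianMatrixLaw K N).real
      {M | η ≤ ‖(N : ℝ)⁻¹ • (M * Mᴴ) - 1‖}) atTop (𝓝 0) := by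
    have := (ENNReal.tendsto_toReal ENNReal.zero_ne_top).comp (tendsto_gaussianMatrixLaw_bad K hη0)
    simpa [Measure.real] using this.const_mul (2 * C)
  filter_upwards [ht.eventually (gt_mem_nhds (half_pos hε))] with N hN h x
  have := abs_integral_boundaryKernel_sub_le h.le (Nat.zero_lt_of_lt h) hf hC hη0.le hη1 hS x
  linarith

end Comparison

/-! ### Symmetric extensions and the conclusion -/

theorem integral_symExt {K : ℕ} {g : (Fin K → ℝ) → ℝ} (hg : Continuous g)
    (hc : HasCompactSupport g) (μ : Measure (WeylChamber K)) [IsFiniteMeasure μ] :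
    ∫ y, g y ∂symExt μ = ∫ y, ∑ σ : Equiv.Perm (Fin K), g (fun i => y.1 (σ i)) ∂μ := by
  have hm : ∀ σ : Equiv.Perm (Fin K), Measurable fun (y : WeylChamber K) i => y.1 (σ i) :=
    fun σ => measurable_pi_iff.2 fun i => (measurable_pi_apply (σ i)).comp measurable_subtype_coe
  have hi : ∀ ν : Measure (Fin K → ℝ), IsFiniteMeasure ν → Integrable g ν := fun ν _ =>
    hg.integrable_of_hasCompactSupport hc
  rw [symExt, integral_finsetSum_measure fun σ _ => hi _ inferInstance, integral_finsetSum]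
  · exact Finset.sum_congr rfl fun σ _ =>
      integral_map (hm σ).aemeasurable hg.measurable.aestronglyMeasurable
  · exact fun σ _ => (hi (μ.map fun (y : WeylChamber K) i => y.1 (σ i))
      inferInstance).comp_measurable (hm σ)

end CornerKernels

end

theorem theorem2p13 (K : ℕ) (hK : 1 ≤ K) (g : (Fin K → ℝ) → ℝ) (hg : ContDiff ℝ (⊤ : ℕ∞) g)
    (hc : HasCompactSupport g) :
    Tendsto
      (fun N : ℕ => ⨆ (h : K < N) (x : WeylChamber N),
        ‖(∫ y, g y ∂(symExt (boundaryKernel K (embed x))))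
          - ∫ y, g y ∂(symExt (cornerKernel K h.le x))‖ₑ)
      atTop (𝓝 0) ∧
    Tendsto
      (fun N : ℕ => ⨆ (h : K < N) (x : PosWeylChamber N),
        ‖(∫ y, g y ∂(symExt (boundaryKernelPos K (embedPos x))))
          - ∫ y, g y ∂(symExt (cornerKernel K h.le x.1))‖ₑ)
      atTop (𝓝 0) := by
  have hg' := hg.continuous
  -- Integrating `g` against a symmetric extension is integrating its symmetrisation `f` over the
  -- chamber. Permutations preserve the sup norm, so `f` vanishes outside the same ball as `g`.
  let f : WeylChamber K → ℝ := fun y => ∑ σ : Equiv.Perm (Fin K), g fun i => y.1 (σ i)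
  have hf : Continuous f := continuous_finsetSum _ fun σ _ => hg'.comp (continuous_pi fun i =>
    (continuous_apply (σ i)).comp continuous_subtype_val)
  obtain ⟨R, hR⟩ := hc.isCompact.isBounded.exists_norm_le
  have hfR : ∀ y, f y ≠ 0 → ‖y.1‖ ≤ R := fun y hy => by
    obtain ⟨σ, -, hσ⟩ := Finset.exists_ne_zero_of_sum_ne_zero hy
    have h1 := hR _ (subset_tsupport g hσ)
    refine (pi_norm_le_iff_of_nonneg ((norm_nonneg _).trans h1)).2 fun i => ?_
    simpa using (norm_le_pi_norm (fun i => y.1 (σ i)) (σ.symm i)).trans h1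
  have key : ∀ ε : ℝ≥0∞, 0 < ε → ∀ᶠ N : ℕ in atTop, ∀ (h : K < N) (x : WeylChamber N),
      ‖(∫ y, g y ∂(symExt (boundaryKernel K (embed x))))
        - ∫ y, g y ∂(symExt (cornerKernel K h.le x))‖ₑ ≤ ε := fun ε hε => by
    -- `ε` may be infinite, so a finite positive `δ` below it is used.
    obtain ⟨δ, hδ0, hδ⟩ := ENNReal.lt_iff_exists_nnreal_btwn.1 hε
    have hδ' : (0 : ℝ) < δ := by exact_mod_cast hδ0
    filter_upwards [eventually_abs_integral_sub_le hf hfR hδ'] with N hN h x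
    have : IsFiniteMeasure (cornerKernel K h.le x) := by
      rw [cornerKernel_apply]; infer_instance
    rw [integral_symExt hg' hc, integral_symExt hg' hc]
    refine le_trans ?_ hδ.le
    rw [enorm_le_coe]
    exact hN h x
  -- For `N ≤ K` the supremum is over an empty family and equals `0`. The second case is the first
  -- one restricted to nonnegative `x`.
  refine ⟨ENNReal.tendsto_nhds_zero.2 fun ε hε => ?_, ENNReal.tendsto_nhds_zero.2 fun ε hε => ?_⟩
  · filter_upwards [key ε hε] with N hN
    exact iSup₂_le fun h x => hN h x
  · filter_upwards [key ε hε] with N hN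
    refine iSup₂_le fun h x => ?_
    rw [boundaryKernelPos_embedPos]
    exact hN h x.1
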